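/- Let $k$ be an algebraically closed field of characteristic $0$. For a coalgebra $C$ over $k$, let $C_0$ be its coradical (the sum of its simple subcoalgebras) and $C_{n+1}=\Delta^{-1}(C\otimes C_n+C_0\otimes C)$ its coradical filtration; $C$ is pointed if all its simple subcoalgebras are one-dimensional. For group-like elements $g,h$ put $P_{g,h}(C)=\{x\in C:\Delta(x)=x\otimes h+g\otimes x\}$. Let $\mathbb G_N$ be the group of $N$-th roots of $1$ in $k$. **(I)** Let $M>1$ and $N>2$ be integers, $q\in k$ a primitive $N$-th root of $1$, and for $\lambda\in k$ let $\mathcal B(\lambda)=\mathcal B(M,N,q,\lambda)$ be the $k$-algebra presented by generators $h,a_1,a_2$ and relations $$h^{NM}=1,\quad ha_1=qa_1h,\quad ha_2=q^{-1}a_2h,\quad a_1^N=1-h^N,\quad a_2^N=1-h^N,\quad a_2a_1-qa_1a_2=\lambda(1-h^2).$$ Then: 1. $\dim_k\mathcal B(\lambda)=MN^3$, and there is a unique Hopf algebra structure on the algebra $\mathcal B(\lambda)$ with $\Delta(h)=h\otimes h$ and $\Delta(a_i)=a_i\otimes 1+h\otimes a_i$ for $i=1,2$. 2. The Hopf algebra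 $\mathcal B(\lambda)$ is pointed, its group-like elements are exactly the powers of $h$, and $h$ has order $MN$. For every $n\ge 0$ the $n$-th term of its coradical filtration is $$\mathcal B(\lambda)_n=\langle h^ia_1^{j_1}a_2^{j_2}:\ 0\le i\le NM,\ j_1,j_2\ge 0,\ j_1+j_2\le n\rangle .$$ Moreover $P_{h,1}(\mathcal B(\lambda))=k(1-h)\oplus ka_1\oplus ka_2$ with $1-h$, $a_1$, $a_2$ linearly independent, and $P_{g,1}(\mathcal B(\lambda))=k(1-g)$ for every group-like $g\ne h$. 3. For $\lambda,\widetilde\lambda\in k$, the Hopf algebras $\mathcal B(\lambda)$ and $\mathcal B(\widetilde\lambda)$ are isomorphic if and only if $\widetilde\lambda=u\lambda$ for some $u\in\mathbb G_N$. **(II)** Let $p$ be an odd prime. Then $k$ contains a primitive $p$-th root of $1$, and for every such root $q$ there is a sequence $(\lambda_n)_{n\in\mathbb N}$ in $k$ such that the $\mathcal B(p,p,q,\lambda_n)$ are pairwise non-isomorphic pointed Hopf algebras of dimension $p^4$. In particular Kaplansky's conjecture, that over a field whose characteristic does not divide a positive integer $d$ there are only finitely many Hopf algebras of dimension $d$ up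 to isomorphism, fails over $k$ for $d=p^4$. -/

import Mathlib

open scoped TensorProduct

/-! ### Coalgebra notions -/

section Coalgebras

variable (k : Type*) {C : Type*} [Field k] [AddCommGroup C] [Module k C] [Coalgebra k C]

/-- A subspace `D` of a coalgebra is a subcoalgebra if `Δ(D) ⊆ D ⊗ D`. -/
def IsSubcoalgebra (D : Submodule k C) : Prop :=
  ∀ x ∈ D, Coalgebra.comul (R := k) x ∈ LinearMap.range (TensorProduct.mapIncl D D)

/-- A subcoalgebra is simple if it is nonzero and its only subcoalgebras are `0` and itself. -/
structure IsSimpleSubcoalgebra (D : Submodule k C) : Prop where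
  isSubcoalgebra : IsSubcoalgebra k D
  ne_bot : D ≠ ⊥
  eq_bot_or_eq : ∀ E : Submodule k C, E ≤ D → IsSubcoalgebra k E → E = ⊥ ∨ E = D

variable (C)

/-- A coalgebra is pointed if all its simple subcoalgebras are one-dimensional. -/
def IsPointedCoalgebra : Prop :=
  ∀ D : Submodule k C, IsSimpleSubcoalgebra k D → Module.finrank k D = 1

/-- The coradical: the sum of all simple subcoalgebras. -/
def coradical : Submodule k C :=
  sSup {D : Submodule k C | IsSimpleSubcoalgebra k D}

/-- The coradical filtration: `C₀` is the coradical and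
`Cₙ₊₁ = Δ⁻¹(C ⊗ Cₙ + C₀ ⊗ C)`. -/
noncomputable def coradicalFiltration : ℕ → Submodule k C
  | 0 => coradical k C
  | n + 1 => Submodule.comap (Coalgebra.comul (R := k) (A := C))
      (LinearMap.range (LinearMap.lTensor C (coradicalFiltration n).subtype) ⊔
        LinearMap.range (LinearMap.rTensor C (coradical k C).subtype))

variable {C}

/-- The space `P_{g,h}` of `(g,h)`-skew-primitive elements: `Δ(x) = x ⊗ h + g ⊗ x`. -/
def skewPrimitives (g h : C) : Submodule k C where
  carrier := {x | Coalgebra.comul (R := k) x = x ⊗ₜ[k] h + g ⊗ₜ[k] x}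
  add_mem' := by
    intro x y hx hy
    simp only [Set.mem_ofPred_eq] at hx hy ⊢
    rw [map_add, hx, hy, TensorProduct.add_tmul, TensorProduct.tmul_add]
    abel
  zero_mem' := by simp
  smul_mem' := by
    intro c x hx
    simp only [Set.mem_ofPred_eq] at hx ⊢
    rw [map_smul, hx, smul_add, TensorProduct.smul_tmul', TensorProduct.tmul_smul]

end Coalgebras

/-! ### Hopf algebra structures on a given algebra -/

/-- A Hopf algebra structure on a given `k`-algebra `A`: a coalgebra structure on the underlying
vector space whose comultiplication and counit are multiplicative and unital, together with an
antipode. Bundled over a fixed algebra structure; see `HopfStructure.toHopfAlgebra`. -/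
structure HopfStructure (k A : Type*) [Field k] [Ring A] [Algebra k A] extends Coalgebra k A where
  counit_one : counit 1 = 1
  counit_mul : ∀ a b : A, counit (a * b) = counit a * counit b
  comul_one : comul 1 = 1
  comul_mul : ∀ a b : A, comul (a * b) = comul a * comul b
  /-- The antipode. -/
  antipode : A →ₗ[k] A
  mul_antipode_rTensor_comul :
    LinearMap.mul' k A ∘ₗ antipode.rTensor A ∘ₗ comul = Algebra.linearMap k A ∘ₗ counit
  mul_antipode_lTensor_comul :
    LinearMap.mul' k A ∘ₗ antipode.lTensor A ∘ₗ comul = Algebra.linearMap k A ∘ₗ counit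

namespace HopfStructure

/-- A Hopf algebra structure on the algebra `A` makes `A` a Hopf algebra in Mathlib's sense,
with the given underlying algebra. -/
@[reducible] def toHopfAlgebra {k A : Type*} [Field k] [Ring A] [Algebra k A]
    (H : HopfStructure k A) : HopfAlgebra k A :=
  { Bialgebra.mk' k A (C := H.toCoalgebra) H.counit_one (H.counit_mul _ _)
      H.comul_one (H.comul_mul _ _) with
    antipode := H.antipode
    mul_antipode_rTensor_comul := H.mul_antipode_rTensor_comul
    mul_antipode_lTensor_comul := H.mul_antipode_lTensor_comul }

/-- Two algebras with Hopf structures are isomorphic as Hopf algebras: there is a bijective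
algebra and coalgebra map (such a map commutes with the antipodes). -/
def Isomorphic {k A A' : Type*} [Field k] [Ring A] [Algebra k A] [Ring A'] [Algebra k A']
    (H : HopfStructure k A) (H' : HopfStructure k A') : Prop :=
  letI := H.toCoalgebra
  letI := H'.toCoalgebra
  Nonempty (A ≃ₐc[k] A')

end HopfStructure

/-- Finiteness of types in dimension `n` over `k`: if the characteristic of `k` does not divide
`n`, then there are, up to isomorphism, only finitely many Hopf algebras of dimension `n`.
(Every finite-dimensional Hopf algebra over `k` has a copy in the universe of `k`.) -/
def KaplanskyFiniteness.{u} (k : Type u) [Field k] (n : ℕ) : Prop :=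
  (n : k) ≠ 0 → ∃ (m : ℕ) (S : Fin m → HopfAlgCat.{u, u} k), ∀ A : HopfAlgCat.{u, u} k,
    Module.finrank k A = n → ∃ i, Nonempty (A ≃ₐc[k] S i)

/-! ### The algebras `B(M, N, q, λ)` -/

namespace LiftedPlane

/-- Names of the three generators. -/
inductive Gen : Type
  | h
  | a₁
  | a₂

section

variable {k : Type*} [Field k]

/-- The defining relations, in the free algebra on `h, a₁, a₂`. -/
inductive Rel (M N : ℕ) (q lam : k) : FreeAlgebra k Gen → FreeAlgebra k Gen → Prop
  | h_pow : Rel M N q lam (FreeAlgebra.ι k Gen.h ^ (N * M)) 1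
  | h_a₁ : Rel M N q lam (FreeAlgebra.ι k Gen.h * FreeAlgebra.ι k Gen.a₁)
      (q • (FreeAlgebra.ι k Gen.a₁ * FreeAlgebra.ι k Gen.h))
  | h_a₂ : Rel M N q lam (FreeAlgebra.ι k Gen.h * FreeAlgebra.ι k Gen.a₂)
      (q⁻¹ • (FreeAlgebra.ι k Gen.a₂ * FreeAlgebra.ι k Gen.h))
  | a₁_pow : Rel M N q lam (FreeAlgebra.ι k Gen.a₁ ^ N) (1 - FreeAlgebra.ι k Gen.h ^ N)
  | a₂_pow : Rel M N q lam (FreeAlgebra.ι k Gen.a₂ ^ N) (1 - FreeAlgebra.ι k Gen.h ^ N)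
  | a₂_a₁ : Rel M N q lam
      (FreeAlgebra.ι k Gen.a₂ * FreeAlgebra.ι k Gen.a₁
        - q • (FreeAlgebra.ι k Gen.a₁ * FreeAlgebra.ι k Gen.a₂))
      (lam • (1 - FreeAlgebra.ι k Gen.h ^ 2))

/-- The algebra `B(M, N, q, λ)` presented by the generators `h, a₁, a₂` and the relations `Rel`. -/
abbrev B (M N : ℕ) (q lam : k) : Type _ := RingQuot (Rel M N q lam)

variable (M N : ℕ) (q lam : k)

/-- The class of a generator in `B(M, N, q, λ)`. -/
noncomputable def gen (x : Gen) : B M N q lam :=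
  RingQuot.mkAlgHom k (Rel M N q lam) (FreeAlgebra.ι k x)

/-- The generator `h`. -/
noncomputable abbrev h : B M N q lam := gen M N q lam Gen.h

/-- The generator `a₁`. -/
noncomputable abbrev a₁ : B M N q lam := gen M N q lam Gen.a₁

/-- The generator `a₂`. -/
noncomputable abbrev a₂ : B M N q lam := gen M N q lam Gen.a₂

variable {M N q lam}

/-- The Hopf structure is given on generators by `Δ(h) = h ⊗ h` and
`Δ(aᵢ) = aᵢ ⊗ 1 + h ⊗ aᵢ`. -/
structure IsStandard (H : HopfStructure k (B M N q lam)) : Prop where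
  comul_h : H.comul (h M N q lam) = h M N q lam ⊗ₜ[k] h M N q lam
  comul_a₁ : H.comul (a₁ M N q lam) =
    a₁ M N q lam ⊗ₜ[k] (1 : B M N q lam) + h M N q lam ⊗ₜ[k] a₁ M N q lam
  comul_a₂ : H.comul (a₂ M N q lam) =
    a₂ M N q lam ⊗ₜ[k] (1 : B M N q lam) + h M N q lam ⊗ₜ[k] a₂ M N q lam

end

end LiftedPlane

/-! Rewriting shows that the restricted monomials h^l a₁^i a₂^j (l mod MN, i, j < N) span the
presented algebra; the difficulty is their independence. No confluence check is made. The
comultiplication does the work, and the only input about the presentation is that h has order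
exactly MN (`orderOf_h`). This comes from a representation on functions on Z/N: h acts diagonally
with a primitive MN-th root of 1 among its eigenvalues, a₁ and a₂ act by opposite weighted shifts,
and algebraic closedness supplies the weights.

The Hopf structure exists because the proposed images of the generators under Δ, ε and S again
satisfy the relations (`relations_counit`, `Relations.tensor`, `Relations.op`). The key point is
that (x + y)^N = x^N + y^N when yx = qxy and q is a primitive N-th root of 1.

By the q-binomial theorem, Δ of a restricted monomial is a sum over all splittings of its exponents,
with nonzero coefficients (`Relations.isQuantumPlaneComul`). The powers of h are distinct
group-likes, hence independent. Since a_i^N = 1 - h^N ≠ 0, the a_i are nonzero; the eigenvalues 1,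
q, q⁻¹ of conjugation by h, distinct as N > 2, then give independence in degree at most one. Pairing
Δ with dual functionals raises this to all degrees (`IsQuantumPlaneComul.linearIndepOn`). The same
pairing bounds the coradical filtration and the skew-primitives, while slicing Δ finds the simple
subcoalgebras.

A Hopf isomorphism must fix h and multiply each a_i by an N-th root of 1, so the last relation
changes λ by such a root (`exists_eq_mul_of_equiv`); conversely a₁ can be rescaled
(`isomorphic_of_eq_mul`). Hence λ^N is an invariant, and λ = 0, 1, 2, … gives infinitely many
classes. -/

/-! ### Gaussian binomial coefficients -/

section GaussBinom

variable {k : Type*} [Field k]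

/-- The coefficient of `x ^ r * y ^ s` in `(x + y) ^ (r + s)` when `y * x = q • (x * y)`. -/
def gaussBinom (q : k) : ℕ → ℕ → k
  | 0, _ => 1
  | _ + 1, 0 => 1
  | r + 1, s + 1 => gaussBinom q (r + 1) s + q ^ (s + 1) * gaussBinom q r (s + 1)

/-- The `q`-number `1 + q + ⋯ + q ^ (n - 1)`. -/
def qNumber (q : k) (n : ℕ) : k := ∑ i ∈ Finset.range n, q ^ i

/-- The `q`-factorial. -/
def qFactorial (q : k) (n : ℕ) : k := ∏ i ∈ Finset.range n, qNumber q (i + 1)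

@[simp] lemma gaussBinom_zero_left (q : k) (s : ℕ) : gaussBinom q 0 s = 1 := by
  rw [gaussBinom]

@[simp] lemma gaussBinom_zero_right (q : k) (r : ℕ) : gaussBinom q r 0 = 1 := by
  cases r <;> rw [gaussBinom]

lemma qNumber_add (q : k) (m n : ℕ) :
    qNumber q (m + n) = qNumber q m + q ^ m * qNumber q n := by
  simp [qNumber, Finset.sum_range_add, pow_add, Finset.mul_sum]

lemma qFactorial_succ (q : k) (n : ℕ) :
    qFactorial q (n + 1) = qFactorial q n * qNumber q (n + 1) := by
  simp [qFactorial, Finset.prod_range_succ]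

/-- Pascal's rule combined with [r + s + 2] = [s + 1] + q^(s+1) [r + 1]. The form without division
stays meaningful at roots of unity, where some factorials vanish. -/
lemma gaussBinom_mul_qFactorial (q : k) (r s : ℕ) :
    gaussBinom q r s * qFactorial q r * qFactorial q s = qFactorial q (r + s) := by
  induction r generalizing s with
  | zero => simp [qFactorial]
  | succ r ihr =>
    induction s with
    | zero => simp [qFactorial]
    | succ s ihs =>
      have h1 := ihr (s + 1)
      rw [qFactorial_succ q s] at h1
      rw [qFactorial_succ q r] at ihs
      rw [gaussBinom, show r + 1 + (s + 1) = (r + s + 1) + 1 by ring, qFactorial_succ q (r + s + 1),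
        show r + s + 1 + 1 = (s + 1) + (r + 1) by ring, qNumber_add q (s + 1) (r + 1),
        qFactorial_succ q r, qFactorial_succ q s]
      rw [show r + 1 + s = r + s + 1 by ring] at ihs
      rw [show r + (s + 1) = r + s + 1 by ring] at h1
      linear_combination qNumber q (s + 1) * ihs + q ^ (s + 1) * qNumber q (r + 1) * h1

lemma IsPrimitiveRoot.qNumber_ne_zero {q : k} {N n : ℕ} (hq : IsPrimitiveRoot q N) (hn : 0 < n)
    (hnN : n < N) : qNumber q n ≠ 0 := by
  intro h0
  have h1 : qNumber q n * (q - 1) = q ^ n - 1 := geom_sum_mul q n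
  rw [h0, zero_mul] at h1
  exact hq.pow_ne_one_of_pos_of_lt hn.ne' hnN (sub_eq_zero.1 h1.symm)

lemma IsPrimitiveRoot.qFactorial_ne_zero {q : k} {N n : ℕ} (hq : IsPrimitiveRoot q N)
    (hnN : n < N) : qFactorial q n ≠ 0 := by
  rw [qFactorial, Finset.prod_ne_zero_iff]
  intro i hi
  exact hq.qNumber_ne_zero (Nat.succ_pos i) (by have := Finset.mem_range.1 hi; omega)

lemma IsPrimitiveRoot.gaussBinom_ne_zero {q : k} {N r s : ℕ} (hq : IsPrimitiveRoot q N)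
    (h : r + s < N) : gaussBinom q r s ≠ 0 := by
  intro h0
  have h1 := gaussBinom_mul_qFactorial q r s
  rw [h0, zero_mul, zero_mul] at h1
  exact hq.qFactorial_ne_zero h h1.symm

/-- The factorial of N contains [N] = 0, whereas the factorials of r and s, both below N, do not
vanish. -/
lemma IsPrimitiveRoot.gaussBinom_eq_zero {q : k} {N r s : ℕ} (hq : IsPrimitiveRoot q N)
    (hN : 1 < N) (hr : r ≠ 0) (hs : s ≠ 0) (h : r + s = N) : gaussBinom q r s = 0 := by
  have h1 := gaussBinom_mul_qFactorial q r s
  have h2 : qFactorial q N = 0 := by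
    obtain ⟨n, rfl⟩ : ∃ n, N = n + 1 := ⟨N - 1, by omega⟩
    rw [qFactorial_succ, qNumber, hq.geom_sum_eq_zero hN, mul_zero]
  rw [h, h2, mul_assoc] at h1
  exact (mul_eq_zero.1 h1).resolve_right
    (mul_ne_zero (hq.qFactorial_ne_zero (by omega)) (hq.qFactorial_ne_zero (by omega)))

/-! ### The q-binomial theorem for q-commuting elements -/

section Ring

variable {A : Type*} [Ring A] [Algebra k A] {q : k} {x y : A}

lemma mul_pow_of_qcomm (hyx : y * x = q • (x * y)) (s : ℕ) : y * x ^ s = q ^ s • (x ^ s * y) := by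
  induction s with
  | zero => simp
  | succ s ih =>
    rw [pow_succ, ← mul_assoc, ih, smul_mul_assoc, mul_assoc, hyx, mul_smul_comm, smul_smul,
      pow_succ, mul_assoc]

lemma pow_mul_of_qcomm (hyx : y * x = q • (x * y)) (s : ℕ) : y ^ s * x = q ^ s • (x * y ^ s) := by
  induction s with
  | zero => simp
  | succ s ih =>
    rw [pow_succ, mul_assoc, hyx, mul_smul_comm, ← mul_assoc, ih, smul_mul_assoc, smul_smul,
      mul_assoc, pow_succ, mul_comm q]

lemma pow_mul_pow_of_qcomm (hyx : y * x = q • (x * y)) (r s : ℕ) :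
    y ^ r * x ^ s = q ^ (r * s) • (x ^ s * y ^ r) := by
  rw [pow_mul q r s]
  exact mul_pow_of_qcomm (pow_mul_of_qcomm hyx r) s

/-- The `q`-binomial theorem. -/
theorem add_pow_of_qcomm (hyx : y * x = q • (x * y)) (n : ℕ) :
    (x + y) ^ n = ∑ p ∈ Finset.HasAntidiagonal.antidiagonal n, gaussBinom q p.1 p.2 • (x ^ p.1 * y ^ p.2) := by
  induction n with
  | zero => simp
  | succ n ih =>
    -- The two summands of Pascal's rule: α collects the words ending in y, β those ending in x.
    -- Setting them to 0 on one edge makes the boundary cases uniform.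
    set α : ℕ × ℕ → A := fun p ↦
      (if p.2 = 0 then 0 else gaussBinom q p.1 (p.2 - 1)) • (x ^ p.1 * y ^ p.2) with hα
    set β : ℕ × ℕ → A := fun p ↦
      (if p.1 = 0 then 0 else q ^ p.2 * gaussBinom q (p.1 - 1) p.2) • (x ^ p.1 * y ^ p.2) with hβ
    have hsplit : ∀ p ∈ Finset.HasAntidiagonal.antidiagonal (n + 1),
        gaussBinom q p.1 p.2 • (x ^ p.1 * y ^ p.2) = α p + β p := by
      rintro ⟨r, s⟩ hp
      rw [Finset.HasAntidiagonal.mem_antidiagonal] at hp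
      simp only [hα, hβ, ← add_smul]
      congr 1
      rcases r with _ | r <;> rcases s with _ | s
      · simp at hp
      · simp
      · simp
      · simp [gaussBinom]
    rw [Finset.sum_congr rfl hsplit, Finset.sum_add_distrib, Finset.Nat.sum_antidiagonal_succ',
      Finset.Nat.sum_antidiagonal_succ (f := β), pow_succ, ih, mul_add, Finset.sum_mul,
      Finset.sum_mul, add_comm]
    congr 1
    · simp [hα, pow_succ, mul_assoc]
    · simp [hβ, mul_assoc, pow_mul_of_qcomm hyx, smul_smul, pow_succ, mul_comm]

/-- All mixed coefficients of total degree N vanish. This is what makes the relations a_i^N = 1 -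
h^N compatible with Δ. -/
theorem IsPrimitiveRoot.add_pow_of_qcomm {N : ℕ} (hq : IsPrimitiveRoot q N) (hN : 1 < N)
    (hyx : y * x = q • (x * y)) : (x + y) ^ N = x ^ N + y ^ N := by
  rw [_root_.add_pow_of_qcomm hyx]
  rw [← Finset.sum_subset (s₁ := {(N, 0), (0, N)})]
  · rw [Finset.sum_pair (by simp; omega)]
    simp
  · intro p hp
    simp only [Finset.mem_insert, Finset.mem_singleton] at hp
    rcases hp with rfl | rfl <;> simp
  · rintro ⟨r, s⟩ hp hp'
    simp only [Finset.mem_insert, Finset.mem_singleton, Prod.mk.injEq, not_or,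
      Finset.HasAntidiagonal.mem_antidiagonal] at hp hp'
    rw [hq.gaussBinom_eq_zero hN (by omega) (by omega) hp, zero_smul]

end Ring

end GaussBinom

/-! ### Coalgebras with a bigraded basis -/

section Slices

variable {k C : Type*} [Field k] [AddCommGroup C] [Module k C]

/-- The functional `φ ⊗ ψ` on `C ⊗ C`. -/
noncomputable def tensorPairing (φ ψ : C →ₗ[k] k) : C ⊗[k] C →ₗ[k] k :=
  LinearMap.mul' k k ∘ₗ TensorProduct.map φ ψ

/-- The map `id ⊗ f : C ⊗ C → C`. -/
noncomputable def sliceRight (f : C →ₗ[k] k) : C ⊗[k] C →ₗ[k] C :=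
  (TensorProduct.rid k C).toLinearMap ∘ₗ f.lTensor C

@[simp] lemma tensorPairing_tmul (φ ψ : C →ₗ[k] k) (x y : C) :
    tensorPairing φ ψ (x ⊗ₜ y) = φ x * ψ y := by
  simp [tensorPairing]

@[simp] lemma sliceRight_tmul (f : C →ₗ[k] k) (x y : C) :
    sliceRight f (x ⊗ₜ y) = f y • x := by
  simp [sliceRight]

/-- The summand C ⊗ D is killed by ψ and the summand E ⊗ C by φ. This turns the condition defining
the coradical filtration into scalar equations. -/
lemma tensorPairing_eq_zero_of_mem {φ ψ : C →ₗ[k] k} {D E : Submodule k C}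
    (hφ : E ≤ LinearMap.ker φ) (hψ : D ≤ LinearMap.ker ψ) {t : C ⊗[k] C}
    (ht : t ∈ LinearMap.range (LinearMap.lTensor C D.subtype) ⊔
        LinearMap.range (LinearMap.rTensor C E.subtype)) : tensorPairing φ ψ t = 0 := by
  obtain ⟨u, ⟨u, rfl⟩, v, ⟨v, rfl⟩, rfl⟩ := Submodule.mem_sup.1 ht
  clear ht
  rw [map_add]
  have h1 : tensorPairing φ ψ (LinearMap.lTensor C D.subtype u) = 0 := by
    induction u using TensorProduct.induction_on with
    | zero => simp
    | tmul x y => simp [LinearMap.mem_ker.1 (hψ y.2)]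
    | add x y hx hy => simp only [map_add, hx, hy, add_zero]
  have h2 : tensorPairing φ ψ (LinearMap.rTensor C E.subtype v) = 0 := by
    induction v using TensorProduct.induction_on with
    | zero => simp
    | tmul x y => simp [LinearMap.mem_ker.1 (hφ x.2)]
    | add x y hx hy => simp only [map_add, hx, hy, add_zero]
  rw [h1, h2, add_zero]

lemma sliceRight_mem {D : Submodule k C} (f : C →ₗ[k] k) {t : C ⊗[k] C}
    (ht : t ∈ LinearMap.range (TensorProduct.mapIncl D D)) : sliceRight f t ∈ D := by
  obtain ⟨u, rfl⟩ := ht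
  induction u using TensorProduct.induction_on with
  | zero => simp
  | tmul x y =>
    simp only [TensorProduct.mapIncl, TensorProduct.map_tmul, sliceRight_tmul,
      Submodule.subtype_apply]
    exact D.smul_mem _ x.2
  | add x y hx hy => simpa only [map_add] using D.add_mem hx hy

/-- The coordinate functional on the span extends to the whole space. Nothing is known about it on
members of the family outside `S`. -/
lemma LinearIndepOn.exists_dual {ι : Type*} [DecidableEq ι] {b : ι → C} {S : Set ι}
    (hb : LinearIndepOn k b S)
    {x : ι} (hx : x ∈ S) : ∃ φ : C →ₗ[k] k, ∀ y ∈ S, φ (b y) = if y = x then 1 else 0 := by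
  have hb' : LinearIndependent k (fun y : S ↦ b y) := hb
  obtain ⟨φ, hφ⟩ := LinearMap.exists_extend
    ((Finsupp.lapply (⟨x, hx⟩ : S)) ∘ₗ hb'.repr)
  refine ⟨φ, fun y hy ↦ ?_⟩
  have h1 := LinearMap.congr_fun hφ ⟨b y, Submodule.subset_span ⟨⟨y, hy⟩, rfl⟩⟩
  simp only [LinearMap.comp_apply, Submodule.subtype_apply,
    Finsupp.lapply_apply] at h1
  rw [h1, hb'.repr_eq_single ⟨y, hy⟩ _ rfl, Finsupp.single_apply]
  simp [Subtype.ext_iff]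

variable [Coalgebra k C]

/-- The counit axiom in the form (ε ⊗ f)Δ = f. It guarantees that a slice of Δ(x) is nonzero
whenever f(x) ≠ 0. -/
lemma counit_sliceRight_comul (f : C →ₗ[k] k) (x : C) :
    Coalgebra.counit (R := k) (sliceRight f (Coalgebra.comul (R := k) x)) = f x := by
  have h1 : ∀ t : C ⊗[k] C, Coalgebra.counit (R := k) (sliceRight f t) =
      f (TensorProduct.lid k C (Coalgebra.counit.rTensor C t)) := by
    intro t
    induction t using TensorProduct.induction_on with
    | zero => simp
    | tmul x y => simp [mul_comm]
    | add x y hx hy => simp only [map_add, hx, hy]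
  rw [h1, Coalgebra.rTensor_counit_comul]
  simp

lemma isSubcoalgebra_span_singleton {g : C} (hg : IsGroupLikeElem k g) :
    IsSubcoalgebra k (Submodule.span k {g}) := by
  intro x hx
  obtain ⟨a, rfl⟩ := Submodule.mem_span_singleton.1 hx
  refine ⟨a • (⟨g, Submodule.mem_span_singleton_self g⟩ ⊗ₜ
    ⟨g, Submodule.mem_span_singleton_self g⟩), ?_⟩
  rw [map_smul, map_smul, hg.comul_eq_tmul_self]
  simp [TensorProduct.mapIncl]

lemma isSimpleSubcoalgebra_span_singleton {g : C} (hg : IsGroupLikeElem k g) :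
    IsSimpleSubcoalgebra k (Submodule.span k {g}) where
  isSubcoalgebra := isSubcoalgebra_span_singleton hg
  ne_bot := by simpa using hg.ne_zero
  eq_bot_or_eq _ hE _ := (nonzero_span_atom g hg.ne_zero).le_iff.1 hE

end Slices

/-- The index set of the restricted monomials of degree at most `d`. -/
def monomialIndex (n N d : ℕ) : Set (ZMod n × ℕ × ℕ) :=
  {z | z.2.1 < N ∧ z.2.2 < N ∧ z.2.1 + z.2.2 ≤ d}

lemma monomialIndex_mono (n N : ℕ) {d e : ℕ} (h : d ≤ e) :
    monomialIndex n N d ⊆ monomialIndex n N e :=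
  fun _ hz ↦ ⟨hz.1, hz.2.1, hz.2.2.trans h⟩

/-- The comultiplication on a family of elements `b (l, i, j)` of a coalgebra is like the one of
the monomials `h ^ l * a₁ ^ i * a₂ ^ j` in a lifted quantum plane. -/
structure IsQuantumPlaneComul {k C : Type*} [Field k] [AddCommGroup C] [Module k C]
    [Coalgebra k C] {n : ℕ} (N : ℕ) (c : ℕ × ℕ → ℕ × ℕ → k) (b : ZMod n × ℕ × ℕ → C) : Prop where
  comul : ∀ l i j, i < N → j < N → Coalgebra.comul (R := k) (b (l, i, j)) =
    ∑ p ∈ Finset.HasAntidiagonal.antidiagonal i, ∑ s ∈ Finset.HasAntidiagonal.antidiagonal j,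
      c p s • (b (l + p.2 + s.2, p.1, s.1) ⊗ₜ[k] b (l, p.2, s.2))
  ne_zero : ∀ p s, p.1 + p.2 < N → s.1 + s.2 < N → c p s ≠ 0
  isGroupLikeElem : ∀ l, IsGroupLikeElem k (b (l, 0, 0))

namespace IsQuantumPlaneComul

variable {k C : Type*} [Field k] [AddCommGroup C] [Module k C] [Coalgebra k C] {n N : ℕ}
  {c : ℕ × ℕ → ℕ × ℕ → k} {b : ZMod n × ℕ × ℕ → C}

/-- If `φ` and `ψ` are dual to two monomials, then `φ ⊗ ψ` detects their product in `Δ`. -/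
lemma tensorPairing_comul (hb : IsQuantumPlaneComul N c b) {d : ℕ} {φ ψ : C →ₗ[k] k} {l : ZMod n}
    {u v u' v' : ℕ} (h1 : 1 ≤ u + v) (h2 : 1 ≤ u' + v') (hd : u + v ≤ d) (hd' : u' + v' ≤ d)
    (hφ : ∀ z ∈ monomialIndex n N d, φ (b z) = if z = (l + u' + v', u, v) then 1 else 0)
    (hψ : ∀ z ∈ monomialIndex n N d, ψ (b z) = if z = (l, u', v') then 1 else 0)
    {z : ZMod n × ℕ × ℕ} (hz : z ∈ monomialIndex n N (d + 1)) :
    tensorPairing φ ψ (Coalgebra.comul (R := k) (b z)) =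
      if z = (l, u + u', v + v') then c (u, u') (v, v') else 0 := by
  obtain ⟨m, i, j⟩ := z
  obtain ⟨hi, hj, hij⟩ := hz
  dsimp only at hi hj hij
  rw [hb.comul m i j hi hj]
  simp only [map_sum, map_smul, tensorPairing_tmul, smul_eq_mul]
  have hterm : ∀ p ∈ Finset.HasAntidiagonal.antidiagonal i,
      ∀ s ∈ Finset.HasAntidiagonal.antidiagonal j,
      c p s * (φ (b (m + p.2 + s.2, p.1, s.1)) * ψ (b (m, p.2, s.2))) =
        if p = (u, u') ∧ s = (v, v') ∧ m = l then c (u, u') (v, v') else 0 := by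
    rintro ⟨r, r'⟩ hp ⟨s, s'⟩ hs
    rw [Finset.HasAntidiagonal.mem_antidiagonal] at hp hs
    dsimp only at hp hs ⊢
    -- If one tensor factor has degree 0, the other may have degree d + 1, where the functionals are
    -- not controlled. Such terms vanish anyway, since both target monomials have positive degree.
    by_cases hr : r + s = 0
    · rw [hφ _ ⟨by dsimp only; omega, by dsimp only; omega, by dsimp only; omega⟩]
      rw [if_neg (by simp only [Prod.mk.injEq]; omega),
        if_neg (by simp only [Prod.mk.injEq]; omega)]
      simp
    by_cases hr' : r' + s' = 0
    · rw [hψ _ ⟨by dsimp only; omega, by dsimp only; omega, by dsimp only; omega⟩]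
      rw [if_neg (by simp only [Prod.mk.injEq]; omega),
        if_neg (by simp only [Prod.mk.injEq]; omega)]
      simp
    rw [hφ _ ⟨by dsimp only; omega, by dsimp only; omega, by dsimp only; omega⟩,
      hψ _ ⟨by dsimp only; omega, by dsimp only; omega, by dsimp only; omega⟩]
    by_cases hc : (r, r') = (u, u') ∧ (s, s') = (v, v') ∧ m = l
    · rw [if_pos hc]
      simp only [Prod.mk.injEq] at hc
      obtain ⟨⟨rfl, rfl⟩, ⟨rfl, rfl⟩, rfl⟩ := hc
      simp
    · rw [if_neg hc]
      by_cases hc2 : (m, r', s') = (l, u', v')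
      · rw [if_neg]
        · simp
        · simp only [Prod.mk.injEq] at hc hc2 ⊢
          tauto
      · rw [if_neg hc2]
        simp
  rw [Finset.sum_congr rfl fun p hp ↦ Finset.sum_congr rfl fun s hs ↦ hterm p hp s hs]
  by_cases hc : (m, i, j) = (l, u + u', v + v')
  · rw [if_pos hc]
    simp only [Prod.mk.injEq] at hc
    obtain ⟨rfl, rfl, rfl⟩ := hc
    rw [Finset.sum_eq_single (u, u'), Finset.sum_eq_single (v, v')]
    · simp
    · rintro s - hs
      rw [if_neg (by tauto)]
    · simp
    · rintro p - hp
      exact Finset.sum_eq_zero fun s _ ↦ if_neg (by tauto)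
    · simp
  · rw [if_neg hc]
    refine Finset.sum_eq_zero fun p hp ↦ Finset.sum_eq_zero fun s hs ↦ if_neg ?_
    rintro ⟨rfl, rfl, rfl⟩
    rw [Finset.HasAntidiagonal.mem_antidiagonal] at hp hs
    exact hc (by rw [← hp, ← hs])

lemma tensorPairing_comul_linearCombination (hb : IsQuantumPlaneComul N c b) {d : ℕ}
    {φ ψ : C →ₗ[k] k} {l : ZMod n}
    {u v u' v' : ℕ} (h1 : 1 ≤ u + v) (h2 : 1 ≤ u' + v') (hd : u + v ≤ d) (hd' : u' + v' ≤ d)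
    (hφ : ∀ z ∈ monomialIndex n N d, φ (b z) = if z = (l + u' + v', u, v) then 1 else 0)
    (hψ : ∀ z ∈ monomialIndex n N d, ψ (b z) = if z = (l, u', v') then 1 else 0)
    {f : ZMod n × ℕ × ℕ →₀ k} (hf : f ∈ Finsupp.supported k k (monomialIndex n N (d + 1))) :
    tensorPairing φ ψ (Coalgebra.comul (R := k) (Finsupp.linearCombination k b f)) =
      f (l, u + u', v + v') * c (u, u') (v, v') := by
  rw [Finsupp.linearCombination_apply, Finsupp.sum, map_sum, map_sum]
  simp only [map_smul, smul_eq_mul]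
  rw [Finset.sum_congr rfl fun z hz ↦ by
    rw [hb.tensorPairing_comul h1 h2 hd hd' hφ hψ ((Finsupp.mem_supported k f).1 hf hz)]]
  rw [Finset.sum_eq_single (l, u + u', v + v')]
  · simp
  · intro z _ hz
    rw [if_neg hz, mul_zero]
  · intro hz
    rw [Finsupp.notMem_support_iff.1 hz, zero_mul]

/-- Coefficients in degree at least two vanish if all relevant pairings with `Δ` do. -/
lemma coeff_eq_zero (hb : IsQuantumPlaneComul N c b) {d e : ℕ}
    (hS : LinearIndepOn k b (monomialIndex n N d)) (hd : 1 ≤ d)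
    {f : ZMod n × ℕ × ℕ →₀ k} (hf : f ∈ Finsupp.supported k k (monomialIndex n N (d + 1)))
    (hpair : ∀ φ ψ : C →ₗ[k] k, (∀ l, φ (b (l, 0, 0)) = 0) →
      (∀ z ∈ monomialIndex n N d, z.2.1 + z.2.2 ≤ e → ψ (b z) = 0) →
      tensorPairing φ ψ (Coalgebra.comul (R := k) (Finsupp.linearCombination k b f)) = 0)
    {z : ZMod n × ℕ × ℕ} (hz : 2 ≤ z.2.1 + z.2.2) (hze : e + 2 ≤ z.2.1 + z.2.2) : f z = 0 := by
  by_cases hzm : z ∈ monomialIndex n N (d + 1)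
  swap
  · exact Finsupp.notMem_support_iff.1 fun h ↦ hzm ((Finsupp.mem_supported k f).1 hf h)
  obtain ⟨l, i, j⟩ := z
  obtain ⟨hi, hj, hij⟩ := hzm
  dsimp only at hi hj hij hz hze
  -- Split off a single a₁ or a₂ on the left. The left factor then has degree 1, so φ kills the
  -- group-likes; the right factor has degree at least e + 1, so ψ kills degrees up to e.
  obtain ⟨u, u', v, v', rfl, rfl, huv⟩ : ∃ u u' v v', i = u + u' ∧ j = v + v' ∧ u + v = 1 := by
    rcases i with _ | i
    · exact ⟨0, 0, 1, j - 1, rfl, by omega, rfl⟩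
    · exact ⟨1, i, 0, j, by omega, by omega, rfl⟩
  have m1 : ((l + u' + v', u, v) : ZMod n × ℕ × ℕ) ∈ monomialIndex n N d :=
    ⟨by dsimp only; omega, by dsimp only; omega, by dsimp only; omega⟩
  have m2 : ((l, u', v') : ZMod n × ℕ × ℕ) ∈ monomialIndex n N d :=
    ⟨by dsimp only; omega, by dsimp only; omega, by dsimp only; omega⟩
  obtain ⟨φ, hφ⟩ := hS.exists_dual m1
  obtain ⟨ψ, hψ⟩ := hS.exists_dual m2
  have h1 := hb.tensorPairing_comul_linearCombination (by omega) (by omega) (by omega) (by omega)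
    hφ hψ hf
  rw [hpair φ ψ] at h1
  · exact (mul_eq_zero.1 h1.symm).resolve_right (hb.ne_zero _ _ hi hj)
  · intro m
    rw [hφ (m, 0, 0) ⟨by dsimp only; omega, by dsimp only; omega, by dsimp only; omega⟩, if_neg]
    simp only [Prod.mk.injEq]
    omega
  · intro z hz hze'
    rw [hψ z hz, if_neg]
    rintro rfl
    dsimp only at hze'
    omega

/-- Monomials are linearly independent as soon as those of degree at most one are. -/
lemma linearIndepOn (hb : IsQuantumPlaneComul N c b)
    (h1 : LinearIndepOn k b (monomialIndex n N 1)) (d : ℕ) :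
    LinearIndepOn k b (monomialIndex n N d) := by
  suffices h : LinearIndepOn k b (monomialIndex n N (d + 1)) from
    h.mono (monomialIndex_mono n N (Nat.le_succ d))
  induction d with
  | zero => exact h1
  | succ d ih =>
    rw [linearIndepOn_iff] at ih ⊢
    intro f hf hf0
    refine ih f ?_ hf0
    rw [Finsupp.mem_supported]
    intro z hz
    have hzm := (Finsupp.mem_supported k f).1 hf hz
    refine ⟨hzm.1, hzm.2.1, ?_⟩
    -- A coefficient in the new top degree, which is at least 2, would be detected by some φ ⊗ ψ on
    -- Δ(0) = 0.
    by_contra hlt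
    refine Finsupp.mem_support_iff.1 hz
      (hb.coeff_eq_zero (e := 0) (linearIndepOn_iff.2 ih) (by omega) hf ?_ (by omega) (by omega))
    intro φ ψ _ _
    rw [hf0, map_zero, map_zero]

end IsQuantumPlaneComul

/-! ### Simple subcoalgebras, coradical filtration and skew-primitives -/

namespace IsQuantumPlaneComul

variable {k C : Type*} [Field k] [AddCommGroup C] [Module k C] {n N : ℕ}
  {b : ZMod n × ℕ × ℕ → C}

lemma mem_span_zero_iff {x : C} (hN : 0 < N) :
    x ∈ Submodule.span k (b '' monomialIndex n N 0) ↔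
      ∃ f : ZMod n →₀ k, Finsupp.linearCombination k (fun l ↦ b (l, 0, 0)) f = x := by
  have h1 : b '' monomialIndex n N 0 = Set.range fun l ↦ b (l, 0, 0) := by
    ext y
    constructor
    · rintro ⟨⟨l, i, j⟩, ⟨_, _, h⟩, rfl⟩
      simp only [Nat.le_zero, Nat.add_eq_zero_iff] at h
      obtain ⟨rfl, rfl⟩ := h
      exact ⟨l, rfl⟩
    · rintro ⟨l, rfl⟩
      exact ⟨_, ⟨hN, hN, le_rfl⟩, rfl⟩
  rw [h1, Finsupp.mem_span_range_iff_exists_finsupp]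
  rfl

variable [Coalgebra k C] {c : ℕ × ℕ → ℕ × ℕ → k}

lemma span_zero_le_coradical (hb : IsQuantumPlaneComul N c b) :
    Submodule.span k (b '' monomialIndex n N 0) ≤ coradical k C := by
  rw [Submodule.span_le]
  rintro _ ⟨⟨l, i, j⟩, ⟨_, _, h⟩, rfl⟩
  simp only [Nat.le_zero, Nat.add_eq_zero_iff] at h
  obtain ⟨rfl, rfl⟩ := h
  exact le_sSup (a := Submodule.span k {b (l, 0, 0)})
    (isSimpleSubcoalgebra_span_singleton (hb.isGroupLikeElem l))
    (Submodule.mem_span_singleton_self _)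

/-- Slicing with a functional that vanishes in degree zero lowers the degree. -/
lemma sliceRight_comul_mem (hb : IsQuantumPlaneComul N c b) {d : ℕ} {f : C →ₗ[k] k}
    (hN : 0 < N)
    (hf : Submodule.span k (b '' monomialIndex n N 0) ≤ LinearMap.ker f) {x : C}
    (hx : x ∈ Submodule.span k (b '' monomialIndex n N (d + 1))) :
    sliceRight f (Coalgebra.comul (R := k) x) ∈ Submodule.span k (b '' monomialIndex n N d) := by
  suffices h : Submodule.span k (b '' monomialIndex n N (d + 1)) ≤
      (Submodule.span k (b '' monomialIndex n N d)).comap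
        (sliceRight f ∘ₗ Coalgebra.comul (R := k)) from h hx
  rw [Submodule.span_le]
  rintro _ ⟨⟨l, i, j⟩, ⟨hi, hj, hij⟩, rfl⟩
  dsimp only at hi hj hij
  simp only [Submodule.comap_coe, Set.mem_preimage, LinearMap.comp_apply, SetLike.mem_coe]
  rw [hb.comul l i j hi hj]
  simp only [map_sum, map_smul, sliceRight_tmul]
  refine Submodule.sum_mem _ fun p hp ↦ Submodule.sum_mem _ fun s hs ↦ Submodule.smul_mem _ _ ?_
  rw [Finset.HasAntidiagonal.mem_antidiagonal] at hp hs
  by_cases h0 : p.2 = 0 ∧ s.2 = 0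
  · rw [h0.1, h0.2, LinearMap.mem_ker.1 (hf (Submodule.subset_span ⟨_, ⟨hN, hN, le_rfl⟩, rfl⟩)),
      zero_smul]
    exact Submodule.zero_mem _
  · exact Submodule.smul_mem _ _ (Submodule.subset_span
      ⟨_, ⟨by dsimp only; omega, by dsimp only; omega, by dsimp only; omega⟩, rfl⟩)

/-- The simple subcoalgebras are the lines spanned by the `b (l, 0, 0)`. -/
lemma exists_eq_span_of_isSimple (hb : IsQuantumPlaneComul N c b) (hN : 0 < N)
    (hS : LinearIndepOn k b (monomialIndex n N 0)) {d : ℕ}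
    (hspan : Submodule.span k (b '' monomialIndex n N d) = ⊤) {D : Submodule k C}
    (hD : IsSimpleSubcoalgebra k D) : ∃ l, D = Submodule.span k {b (l, 0, 0)} := by
  classical
  -- Take the least degree in which D has a nonzero element x. If it were positive, slicing Δ(x) by
  -- a functional f with f(x) ≠ 0 that vanishes on degree 0 would give a nonzero element of D of
  -- smaller degree.
  have hex : ∃ e, D ⊓ Submodule.span k (b '' monomialIndex n N e) ≠ ⊥ :=
    ⟨d, by rw [hspan, inf_top_eq]; exact hD.ne_bot⟩
  have h0 : D ⊓ Submodule.span k (b '' monomialIndex n N 0) ≠ ⊥ := by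
    rcases he : Nat.find hex with _ | e
    · have := Nat.find_spec hex
      rwa [he] at this
    exfalso
    have h1 := Nat.find_spec hex
    rw [he] at h1
    have hmin : ∀ m ≤ e, D ⊓ Submodule.span k (b '' monomialIndex n N m) = ⊥ := fun m hm ↦ by
      by_contra h
      have := Nat.find_min' hex h
      omega
    obtain ⟨x, ⟨hxD, hxe⟩, hx0⟩ := (Submodule.ne_bot_iff _).1 h1
    have hxF : x ∉ Submodule.span k (b '' monomialIndex n N 0) := fun h ↦ hx0 <| by
      have : x ∈ D ⊓ Submodule.span k (b '' monomialIndex n N 0) := ⟨hxD, h⟩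
      rwa [hmin 0 (Nat.zero_le _), Submodule.mem_bot] at this
    obtain ⟨f, hfx, hf⟩ := Submodule.exists_le_ker_of_notMem hxF
    have hy : sliceRight f (Coalgebra.comul (R := k) x) ∈
        D ⊓ Submodule.span k (b '' monomialIndex n N e) :=
      ⟨sliceRight_mem f (hD.isSubcoalgebra x hxD), hb.sliceRight_comul_mem hN hf hxe⟩
    rw [hmin e le_rfl, Submodule.mem_bot] at hy
    apply hfx
    rw [← counit_sliceRight_comul f x, hy, map_zero]
  obtain ⟨x, ⟨hxD, hx⟩, hx0⟩ := (Submodule.ne_bot_iff _).1 h0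
  obtain ⟨a, rfl⟩ := (mem_span_zero_iff hN).1 hx
  have ha : a ≠ 0 := by rintro rfl; simp at hx0
  obtain ⟨l, hl⟩ := Finsupp.support_nonempty_iff.2 ha
  -- Slicing a combination of group-likes by a dual functional isolates one group-like of its
  -- support, which therefore lies in D.
  obtain ⟨ψ, hψ⟩ := hS.exists_dual (x := (l, 0, 0)) ⟨hN, hN, le_rfl⟩
  have hmem := sliceRight_mem ψ (hD.isSubcoalgebra _ hxD)
  have heq : sliceRight ψ (Coalgebra.comul (R := k)
      (Finsupp.linearCombination k (fun l ↦ b (l, 0, 0)) a)) = a l • b (l, 0, 0) := by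
    rw [Finsupp.linearCombination_apply, Finsupp.sum, map_sum, map_sum]
    rw [Finset.sum_eq_single l]
    · rw [map_smul, map_smul, (hb.isGroupLikeElem l).comul_eq_tmul_self, sliceRight_tmul,
        hψ _ ⟨hN, hN, le_rfl⟩, if_pos rfl, one_smul]
    · intro m _ hm
      rw [map_smul, map_smul, (hb.isGroupLikeElem m).comul_eq_tmul_self, sliceRight_tmul,
        hψ _ ⟨hN, hN, le_rfl⟩, if_neg (by simpa using hm), zero_smul, smul_zero]
    · intro h
      exact absurd hl h
  rw [heq, D.smul_mem_iff (Finsupp.mem_support_iff.1 hl)] at hmem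
  refine ⟨l, ?_⟩
  rcases hD.eq_bot_or_eq (Submodule.span k {b (l, 0, 0)})
    ((Submodule.span_singleton_le_iff_mem _ _).2 hmem)
    (isSubcoalgebra_span_singleton (hb.isGroupLikeElem l)) with h | h
  · exact absurd (Submodule.span_singleton_eq_bot.1 h) (hb.isGroupLikeElem l).ne_zero
  · exact h.symm

lemma isPointedCoalgebra (hb : IsQuantumPlaneComul N c b) (hN : 0 < N)
    (hS : LinearIndepOn k b (monomialIndex n N 0)) {d : ℕ}
    (hspan : Submodule.span k (b '' monomialIndex n N d) = ⊤) : IsPointedCoalgebra k C := by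
  intro D hD
  obtain ⟨l, rfl⟩ := hb.exists_eq_span_of_isSimple hN hS hspan hD
  exact finrank_span_singleton (hb.isGroupLikeElem l).ne_zero

lemma exists_eq_of_isGroupLikeElem (hb : IsQuantumPlaneComul N c b) (hN : 0 < N)
    (hS : LinearIndepOn k b (monomialIndex n N 0)) {d : ℕ}
    (hspan : Submodule.span k (b '' monomialIndex n N d) = ⊤) {g : C}
    (hg : IsGroupLikeElem k g) : ∃ l, g = b (l, 0, 0) := by
  obtain ⟨l, hl⟩ := hb.exists_eq_span_of_isSimple hN hS hspan
    (isSimpleSubcoalgebra_span_singleton hg)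
  have h1 : g ∈ Submodule.span k {b (l, 0, 0)} := hl ▸ Submodule.mem_span_singleton_self g
  obtain ⟨a, ha⟩ := Submodule.mem_span_singleton.1 h1
  have h2 := hg.counit_eq_one
  rw [← ha, map_smul, (hb.isGroupLikeElem l).counit_eq_one, smul_eq_mul, mul_one] at h2
  exact ⟨l, by rw [← ha, h2, one_smul]⟩

lemma coradical_eq (hb : IsQuantumPlaneComul N c b) (hN : 0 < N)
    (hS : LinearIndepOn k b (monomialIndex n N 0)) {d : ℕ}
    (hspan : Submodule.span k (b '' monomialIndex n N d) = ⊤) :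
    coradical k C = Submodule.span k (b '' monomialIndex n N 0) := by
  refine le_antisymm (sSup_le fun D hD ↦ ?_) hb.span_zero_le_coradical
  obtain ⟨l, rfl⟩ := hb.exists_eq_span_of_isSimple hN hS hspan hD
  rw [Submodule.span_singleton_le_iff_mem]
  exact Submodule.subset_span ⟨_, ⟨hN, hN, le_rfl⟩, rfl⟩

/-- An element of a quantum plane coalgebra has bounded degree if `Δ` of it does. -/
lemma mem_span_of_comul_mem (hb : IsQuantumPlaneComul N c b)
    (hS : ∀ d, LinearIndepOn k b (monomialIndex n N d)) {d : ℕ} (hN : 0 < N)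
    (hspan : Submodule.span k (b '' monomialIndex n N d) = ⊤) {e : ℕ} {x : C}
    (hx : Coalgebra.comul (R := k) x ∈
      LinearMap.range (LinearMap.lTensor C
        (Submodule.span k (b '' monomialIndex n N e)).subtype) ⊔
      LinearMap.range (LinearMap.rTensor C
        (Submodule.span k (b '' monomialIndex n N 0)).subtype)) :
    x ∈ Submodule.span k (b '' monomialIndex n N (e + 1)) := by
  -- The bound exceeds d, so the family spans, and has the form (d + e + 1) + 1 with first part at
  -- least 1, as `coeff_eq_zero` requires.
  obtain ⟨f, hf, rfl⟩ : ∃ f ∈ Finsupp.supported k k (monomialIndex n N (d + e + 2)),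
      Finsupp.linearCombination k b f = x := by
    rw [← Finsupp.mem_span_image_iff_linearCombination]
    refine Submodule.span_mono (Set.image_mono (monomialIndex_mono n N (d := d) (by omega))) ?_
    rw [hspan]
    trivial
  rw [Finsupp.mem_span_image_iff_linearCombination]
  refine ⟨f, ?_, rfl⟩
  rw [Finsupp.mem_supported]
  intro z hz
  have hzm := (Finsupp.mem_supported k f).1 hf hz
  refine ⟨hzm.1, hzm.2.1, ?_⟩
  by_contra hlt
  refine Finsupp.mem_support_iff.1 hz
    (hb.coeff_eq_zero (e := e) (hS (d + e + 1)) (by omega) hf ?_ (by omega) (by omega))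
  intro φ ψ hφ hψ
  refine tensorPairing_eq_zero_of_mem ?_ ?_ hx
  · intro y hy
    obtain ⟨a, rfl⟩ := (mem_span_zero_iff hN).1 hy
    rw [LinearMap.mem_ker, Finsupp.linearCombination_apply, Finsupp.sum, map_sum]
    exact Finset.sum_eq_zero fun l _ ↦ by rw [map_smul, hφ, smul_zero]
  · rw [Submodule.span_le]
    rintro _ ⟨z, hz, rfl⟩
    exact hψ z (monomialIndex_mono n N (by omega) hz) hz.2.2

/-- The upper bound is `mem_span_of_comul_mem`. For the lower bound, each term of Δ of a monomial of
degree at most e + 1 has a group-like left factor or a right factor of degree at most e. -/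
theorem coradicalFiltration_eq (hb : IsQuantumPlaneComul N c b)
    (hS : ∀ d, LinearIndepOn k b (monomialIndex n N d)) {d : ℕ} (hN : 0 < N)
    (hspan : Submodule.span k (b '' monomialIndex n N d) = ⊤) (e : ℕ) :
    coradicalFiltration k C e = Submodule.span k (b '' monomialIndex n N e) := by
  induction e with
  | zero => exact hb.coradical_eq hN (hS 0) hspan
  | succ e ih =>
    rw [coradicalFiltration, ih, hb.coradical_eq hN (hS 0) hspan]
    apply le_antisymm
    · intro x hx
      exact hb.mem_span_of_comul_mem hS hN hspan hx
    · rw [Submodule.span_le]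
      rintro _ ⟨⟨l, i, j⟩, ⟨hi, hj, hij⟩, rfl⟩
      dsimp only at hi hj hij
      simp only [Submodule.comap_coe, Set.mem_preimage, SetLike.mem_coe]
      rw [hb.comul l i j hi hj]
      refine Submodule.sum_mem _ fun p hp ↦ Submodule.sum_mem _ fun s hs ↦
        Submodule.smul_mem _ _ ?_
      rw [Finset.HasAntidiagonal.mem_antidiagonal] at hp hs
      by_cases h0 : p.1 + s.1 = 0
      · refine Submodule.mem_sup_right ⟨(⟨b (l + p.2 + s.2, p.1, s.1), Submodule.subset_span
          ⟨_, ⟨?_, ?_, ?_⟩, rfl⟩⟩ : Submodule.span k (b '' monomialIndex n N 0)) ⊗ₜ[k]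
            b (l, p.2, s.2), by simp⟩
        all_goals dsimp only; omega
      · refine Submodule.mem_sup_left ⟨b (l + p.2 + s.2, p.1, s.1) ⊗ₜ[k] (⟨b (l, p.2, s.2),
          Submodule.subset_span ⟨_, ⟨?_, ?_, ?_⟩, rfl⟩⟩ :
            Submodule.span k (b '' monomialIndex n N e)), by simp⟩
        all_goals dsimp only; omega

/-- Unlike in `tensorPairing_comul`, the monomial itself lies in the controlled range, so every
value of φ and ψ is known and the target degrees may be zero. -/
lemma tensorPairing_comul_of_mem (hb : IsQuantumPlaneComul N c b) {d : ℕ} {φ ψ : C →ₗ[k] k}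
    {x y : ZMod n × ℕ × ℕ}
    (hφ : ∀ z ∈ monomialIndex n N d, φ (b z) = if z = x then 1 else 0)
    (hψ : ∀ z ∈ monomialIndex n N d, ψ (b z) = if z = y then 1 else 0)
    {z : ZMod n × ℕ × ℕ} (hz : z ∈ monomialIndex n N d) :
    tensorPairing φ ψ (Coalgebra.comul (R := k) (b z)) =
      if z = (y.1, x.2.1 + y.2.1, x.2.2 + y.2.2) ∧ x.1 = y.1 + y.2.1 + y.2.2 then
        c (x.2.1, y.2.1) (x.2.2, y.2.2) else 0 := by
  obtain ⟨m, i, j⟩ := z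
  obtain ⟨x, u, v⟩ := x
  obtain ⟨y, u', v'⟩ := y
  obtain ⟨hi, hj, hij⟩ := hz
  dsimp only at hi hj hij ⊢
  rw [hb.comul m i j hi hj]
  simp only [map_sum, map_smul, tensorPairing_tmul, smul_eq_mul]
  have hterm : ∀ p ∈ Finset.HasAntidiagonal.antidiagonal i,
      ∀ s ∈ Finset.HasAntidiagonal.antidiagonal j,
      c p s * (φ (b (m + p.2 + s.2, p.1, s.1)) * ψ (b (m, p.2, s.2))) =
        if p = (u, u') ∧ s = (v, v') ∧ m = y ∧ x = y + u' + v' then c (u, u') (v, v') else 0 := by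
    rintro ⟨r, r'⟩ hp ⟨s, s'⟩ hs
    rw [Finset.HasAntidiagonal.mem_antidiagonal] at hp hs
    dsimp only at hp hs ⊢
    rw [hφ _ ⟨by dsimp only; omega, by dsimp only; omega, by dsimp only; omega⟩,
      hψ _ ⟨by dsimp only; omega, by dsimp only; omega, by dsimp only; omega⟩]
    by_cases hc : (r, r') = (u, u') ∧ (s, s') = (v, v') ∧ m = y ∧ x = y + u' + v'
    · rw [if_pos hc]
      simp only [Prod.mk.injEq] at hc
      obtain ⟨⟨rfl, rfl⟩, ⟨rfl, rfl⟩, rfl, rfl⟩ := hc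
      simp
    · rw [if_neg hc]
      by_cases hc2 : (m, r', s') = (y, u', v')
      · rw [if_neg]
        · simp
        · simp only [Prod.mk.injEq] at hc hc2 ⊢
          rintro ⟨h, rfl, rfl⟩
          obtain ⟨rfl, rfl, rfl⟩ := hc2
          exact hc ⟨⟨rfl, rfl⟩, ⟨rfl, rfl⟩, rfl, h.symm⟩
      · rw [if_neg hc2]
        simp
  rw [Finset.sum_congr rfl fun p hp ↦ Finset.sum_congr rfl fun s hs ↦ hterm p hp s hs]
  by_cases hc : (m, i, j) = (y, u + u', v + v') ∧ x = y + u' + v'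
  · rw [if_pos hc]
    simp only [Prod.mk.injEq] at hc
    obtain ⟨⟨rfl, rfl, rfl⟩, rfl⟩ := hc
    rw [Finset.sum_eq_single (u, u'), Finset.sum_eq_single (v, v')]
    · simp
    · rintro s - hs
      rw [if_neg (by tauto)]
    · simp
    · rintro p - hp
      exact Finset.sum_eq_zero fun s _ ↦ if_neg (by tauto)
    · simp
  · rw [if_neg hc]
    refine Finset.sum_eq_zero fun p hp ↦ Finset.sum_eq_zero fun s hs ↦ if_neg ?_
    rintro ⟨rfl, rfl, rfl, rfl⟩
    rw [Finset.HasAntidiagonal.mem_antidiagonal] at hp hs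
    exact hc ⟨by rw [← hp, ← hs], rfl⟩

/-- A skew-primitive has degree at most one by `mem_span_of_comul_mem` with e = 0. Pairing its
defining identity with dual functionals then gives scalar equations for the remaining coefficients.
-/
lemma exists_eq_of_mem_skewPrimitives (hb : IsQuantumPlaneComul N c b)
    (hS : ∀ d, LinearIndepOn k b (monomialIndex n N d)) {d : ℕ} (hN : 1 < N)
    (hspan : Submodule.span k (b '' monomialIndex n N d) = ⊤) {t : ZMod n} {x : C}
    (hx : x ∈ skewPrimitives k (b (t, 0, 0)) (b (0, 0, 0))) :
    ∃ α β γ : k, x = α • (b (0, 0, 0) - b (t, 0, 0)) + β • b (0, 1, 0) + γ • b (0, 0, 1) ∧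
      (t ≠ 1 → β = 0 ∧ γ = 0) := by
  have hΔ : Coalgebra.comul (R := k) x = x ⊗ₜ[k] b (0, 0, 0) + b (t, 0, 0) ⊗ₜ[k] x := hx
  have h0 : ∀ l, ((l, 0, 0) : ZMod n × ℕ × ℕ) ∈ monomialIndex n N 1 := fun l ↦
    ⟨by dsimp only; omega, by dsimp only; omega, by dsimp only; omega⟩
  have h1 : ∀ l, ((l, 1, 0) : ZMod n × ℕ × ℕ) ∈ monomialIndex n N 1 := fun l ↦
    ⟨hN, by dsimp only; omega, le_rfl⟩
  have h2 : ∀ l, ((l, 0, 1) : ZMod n × ℕ × ℕ) ∈ monomialIndex n N 1 := fun l ↦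
    ⟨by dsimp only; omega, hN, le_rfl⟩
  have hxF : x ∈ Submodule.span k (b '' monomialIndex n N 1) := by
    refine hb.mem_span_of_comul_mem hS (by omega) hspan (e := 0) ?_
    have hm : ∀ l, b (l, 0, 0) ∈ Submodule.span k (b '' monomialIndex n N 0) := fun l ↦
      Submodule.subset_span ⟨_, ⟨by dsimp only; omega, by dsimp only; omega, le_rfl⟩, rfl⟩
    rw [hΔ]
    exact Submodule.add_mem_sup ⟨x ⊗ₜ ⟨_, hm 0⟩, by simp⟩ ⟨⟨_, hm t⟩ ⊗ₜ x, by simp⟩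
  obtain ⟨f, hf, rfl⟩ := (Finsupp.mem_span_image_iff_linearCombination k).1 hxF
  have hdual : ∀ (φ : C →ₗ[k] k) (y : ZMod n × ℕ × ℕ),
      (∀ z ∈ monomialIndex n N 1, φ (b z) = if z = y then 1 else 0) →
      φ (Finsupp.linearCombination k b f) = f y := by
    intro φ y hφ
    rw [Finsupp.linearCombination_apply, Finsupp.sum, map_sum, Finset.sum_eq_single y]
    · by_cases hy : y ∈ f.support
      · rw [map_smul, hφ y ((Finsupp.mem_supported k f).1 hf hy), if_pos rfl, smul_eq_mul, mul_one]
      · rw [Finsupp.notMem_support_iff.1 hy, zero_smul, map_zero]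
    · intro z hz hzy
      rw [map_smul, hφ z ((Finsupp.mem_supported k f).1 hf hz), if_neg hzy, smul_zero]
    · intro hy
      rw [Finsupp.notMem_support_iff.1 hy, zero_smul, map_zero]
  have key : ∀ y ∈ monomialIndex n N 1, ∀ z ∈ monomialIndex n N 1,
      (if y.1 = z.1 + z.2.1 + z.2.2 then
        f (z.1, y.2.1 + z.2.1, y.2.2 + z.2.2) * c (y.2.1, z.2.1) (y.2.2, z.2.2) else 0) =
      f y * (if z = (0, 0, 0) then 1 else 0) + (if y = (t, 0, 0) then 1 else 0) * f z := by
    intro y hy z hz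
    obtain ⟨φ, hφ⟩ := (hS 1).exists_dual hy
    obtain ⟨ψ, hψ⟩ := (hS 1).exists_dual hz
    have hR := congrArg (tensorPairing φ ψ) hΔ
    rw [map_add, tensorPairing_tmul, tensorPairing_tmul, hdual φ y hφ, hdual ψ z hψ,
      hφ _ (h0 t), hψ _ (h0 0)] at hR
    simp only [eq_comm (a := (0, 0, 0)) (b := z), eq_comm (a := (t, 0, 0)) (b := y)] at hR
    rw [← hR, Finsupp.linearCombination_apply, Finsupp.sum, map_sum, map_sum]
    simp only [map_smul, smul_eq_mul]
    rw [Finset.sum_congr rfl fun w hw ↦ by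
      rw [hb.tensorPairing_comul_of_mem hφ hψ ((Finsupp.mem_supported k f).1 hf hw)]]
    rw [Finset.sum_eq_single (z.1, y.2.1 + z.2.1, y.2.2 + z.2.2)]
    · simp
    · intro w _ hw
      rw [if_neg (fun h ↦ hw h.1), mul_zero]
    · intro hw
      rw [Finsupp.notMem_support_iff.1 hw, zero_mul]
  have hc1 : c (0, 0) (0, 0) = 1 := by
    obtain ⟨φ, hφ⟩ := (hS 1).exists_dual (h0 0)
    have h := hb.tensorPairing_comul_of_mem hφ hφ (h0 0)
    rw [(hb.isGroupLikeElem 0).comul_eq_tmul_self, tensorPairing_tmul, hφ _ (h0 0)] at h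
    simpa using h.symm
  -- Δ(h^l a₁) contains h^l a₁ ⊗ h^l, while x ⊗ 1 + g ⊗ x allows a right factor h^l beside h^l a₁
  -- only for l = 0.
  have hβ : ∀ l, l ≠ 0 → f (l, 1, 0) = 0 := fun l hl ↦ by
    have h := key _ (h1 l) _ (h0 l)
    simpa [hl, hb.ne_zero (1, 0) (0, 0) (by dsimp only; omega) (by dsimp only; omega)] using h
  have hγ : ∀ l, l ≠ 0 → f (l, 0, 1) = 0 := fun l hl ↦ by
    have h := key _ (h2 l) _ (h0 l)
    simpa [hl, hb.ne_zero (0, 0) (1, 0) (by dsimp only; omega) (by dsimp only; omega)] using h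
  have hα : ∀ l, l ≠ 0 → l ≠ t → f (l, 0, 0) = 0 := fun l hl hlt ↦ by
    have h := key _ (h0 l) _ (h0 l)
    simpa [hl, hlt, hc1] using h
  have hαt : f (t, 0, 0) = if t = 0 then 0 else - f (0, 0, 0) := by
    split_ifs with ht
    · subst ht
      have h := key _ (h0 0) _ (h0 0)
      simpa [hc1] using h
    · have h := key _ (h0 t) _ (h0 0)
      simp [ht] at h
      exact eq_neg_of_add_eq_zero_left h.symm
  refine ⟨f (0, 0, 0), f (0, 1, 0), f (0, 0, 1), ?_, fun ht ↦ ⟨?_, ?_⟩⟩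
  · have hfe : f = f (0, 0, 0) • (Finsupp.single (0, 0, 0) 1 - Finsupp.single (t, 0, 0) 1) +
        f (0, 1, 0) • Finsupp.single (0, 1, 0) 1 + f (0, 0, 1) • Finsupp.single (0, 0, 1) 1 := by
      ext ⟨l, i, j⟩
      by_cases hz : (l, i, j) ∈ monomialIndex n N 1
      · obtain ⟨_, _, hij⟩ := hz
        dsimp only at hij
        obtain ⟨rfl, rfl⟩ | ⟨rfl, rfl⟩ | ⟨rfl, rfl⟩ : (i = 0 ∧ j = 0) ∨ (i = 1 ∧ j = 0) ∨
            (i = 0 ∧ j = 1) := by omega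
        · by_cases hl : l = 0
          · subst hl
            by_cases ht : t = 0
            · subst ht
              simpa using hαt
            · simp [ht]
          · by_cases hlt : l = t
            · subst hlt
              rw [hαt]
              simp [hl]
            · rw [hα l hl hlt]
              simp [Ne.symm hl, Ne.symm hlt]
        · by_cases hl : l = 0
          · subst hl
            simp
          · rw [hβ l hl]
            simp [Ne.symm hl]
        · by_cases hl : l = 0
          · subst hl
            simp
          · rw [hγ l hl]
            simp [Ne.symm hl]
      · rw [Finsupp.notMem_support_iff.1 fun h ↦ hz ((Finsupp.mem_supported k f).1 hf h)]
        have e1 : ∀ m, ((m, 0, 0) : ZMod n × ℕ × ℕ) ≠ (l, i, j) := fun m h ↦ hz (h ▸ h0 m)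
        have e2 : ∀ m, ((m, 1, 0) : ZMod n × ℕ × ℕ) ≠ (l, i, j) := fun m h ↦ hz (h ▸ h1 m)
        have e3 : ∀ m, ((m, 0, 1) : ZMod n × ℕ × ℕ) ≠ (l, i, j) := fun m h ↦ hz (h ▸ h2 m)
        simp [-Prod.mk.injEq, e1, e2, e3]
    conv_lhs => rw [hfe]
    simp [Finsupp.linearCombination_single]
  -- Compare the coefficients of h ⊗ a₁: this term occurs in g ⊗ x only if g = h. The same argument
  -- is then used for a₂.
  · have h := key _ (h0 1) _ (h1 0)
    simpa [Ne.symm ht, hb.ne_zero (0, 1) (0, 0) (by dsimp only; omega) (by dsimp only; omega)]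
      using h
  · have h := key _ (h0 1) _ (h2 0)
    simpa [Ne.symm ht, hb.ne_zero (0, 0) (0, 1) (by dsimp only; omega) (by dsimp only; omega)]
      using h

end IsQuantumPlaneComul

namespace LiftedPlane

/-! ### Algebras satisfying the relations of a lifted quantum plane -/

/-- The elements `h`, `a₁`, `a₂` of an algebra satisfy the defining relations. -/
structure Relations {k A : Type*} [Field k] [Ring A] [Algebra k A] (M N : ℕ) (q lam : k)
    (h a₁ a₂ : A) : Prop where
  h_pow : h ^ (N * M) = 1
  h_a₁ : h * a₁ = q • (a₁ * h)
  h_a₂ : h * a₂ = q⁻¹ • (a₂ * h)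
  a₁_pow : a₁ ^ N = 1 - h ^ N
  a₂_pow : a₂ ^ N = 1 - h ^ N
  a₂_a₁ : a₂ * a₁ - q • (a₁ * a₂) = lam • (1 - h ^ 2)

/-- The monomials `h ^ l * a₁ ^ i * a₂ ^ j`. -/
def monomial {A : Type*} [Ring A] (n : ℕ) (h a₁ a₂ : A) (z : ZMod n × ℕ × ℕ) : A :=
  h ^ z.1.val * a₁ ^ z.2.1 * a₂ ^ z.2.2

lemma pow_val_add_natCast {A : Type*} [Monoid A] {n : ℕ} [NeZero n] {h : A} (hn : h ^ n = 1)
    (l : ZMod n) (m : ℕ) : h ^ (l + m).val = h ^ l.val * h ^ m := by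
  rw [ZMod.val_add, ← pow_eq_pow_mod _ hn, ZMod.val_natCast, pow_add, ← pow_eq_pow_mod _ hn]

namespace Relations

section Algebra

variable {k A : Type*} [Field k] [Ring A] [Algebra k A] {M N : ℕ} {q lam : k} {h a₁ a₂ : A}

lemma h_pow' (H : Relations M N q lam h a₁ a₂) : h ^ (M * N) = 1 := by
  rw [mul_comm]; exact H.h_pow

lemma isUnit_h (H : Relations M N q lam h a₁ a₂) (hMN : M * N ≠ 0) : IsUnit h :=
  IsUnit.of_pow_eq_one H.h_pow' hMN

lemma a₁_pow_mul_h_pow (H : Relations M N q lam h a₁ a₂) (hq : q ≠ 0) (r s : ℕ) :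
    a₁ ^ r * h ^ s = q⁻¹ ^ (s * r) • (h ^ s * a₁ ^ r) := by
  rw [pow_mul_pow_of_qcomm H.h_a₁, smul_smul, ← mul_pow, inv_mul_cancel₀ hq, one_pow, one_smul]

lemma a₂_pow_mul_h_pow (H : Relations M N q lam h a₁ a₂) (hq : q ≠ 0) (r s : ℕ) :
    a₂ ^ r * h ^ s = q ^ (s * r) • (h ^ s * a₂ ^ r) := by
  rw [pow_mul_pow_of_qcomm H.h_a₂, smul_smul, ← mul_pow, mul_inv_cancel₀ hq, one_pow, one_smul]

lemma h_mul_mem (i : ℕ) {x : A}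
    (hx : x ∈ Submodule.span k {x | ∃ i j l : ℕ, x = h ^ i * a₁ ^ j * a₂ ^ l}) :
    h ^ i * x ∈ Submodule.span k {x | ∃ i j l : ℕ, x = h ^ i * a₁ ^ j * a₂ ^ l} := by
  induction hx using Submodule.span_induction with
  | mem x hx =>
    obtain ⟨i', j, l, rfl⟩ := hx
    exact Submodule.subset_span ⟨i + i', j, l, by rw [pow_add]; simp only [mul_assoc]⟩
  | zero => simp
  | add x y _ _ hx hy => rw [mul_add]; exact Submodule.add_mem _ hx hy
  | smul a x _ hx => rw [mul_smul_comm]; exact Submodule.smul_mem _ _ hx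

lemma a₁_mul_mem (H : Relations M N q lam h a₁ a₂) (hq : q ≠ 0) {x : A}
    (hx : x ∈ Submodule.span k {x | ∃ i j l : ℕ, x = h ^ i * a₁ ^ j * a₂ ^ l}) :
    a₁ * x ∈ Submodule.span k {x | ∃ i j l : ℕ, x = h ^ i * a₁ ^ j * a₂ ^ l} := by
  induction hx using Submodule.span_induction with
  | mem x hx =>
    obtain ⟨i, j, l, rfl⟩ := hx
    have h1 := H.a₁_pow_mul_h_pow hq 1 i
    rw [pow_one] at h1
    rw [← mul_assoc, ← mul_assoc, h1, smul_mul_assoc, smul_mul_assoc]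
    exact Submodule.smul_mem _ _ (Submodule.subset_span
      ⟨i, j + 1, l, by rw [pow_succ' a₁]; simp only [mul_assoc]⟩)
  | zero => simp
  | add x y _ _ hx hy => rw [mul_add]; exact Submodule.add_mem _ hx hy
  | smul a x _ hx => rw [mul_smul_comm]; exact Submodule.smul_mem _ _ hx

/-- The only product not in normal order up to a scalar is a₂ a₁^j. Moving a₂ past one a₁ costs a
multiple of 1 - h² times a word with fewer letters, so induction on j applies. -/
lemma a₂_mul_mem (H : Relations M N q lam h a₁ a₂) (hq : q ≠ 0) {x : A}
    (hx : x ∈ Submodule.span k {x | ∃ i j l : ℕ, x = h ^ i * a₁ ^ j * a₂ ^ l}) :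
    a₂ * x ∈ Submodule.span k {x | ∃ i j l : ℕ, x = h ^ i * a₁ ^ j * a₂ ^ l} := by
  induction hx using Submodule.span_induction with
  | mem x hx =>
    obtain ⟨i, j, l, rfl⟩ := hx
    have h1 := H.a₂_pow_mul_h_pow hq 1 i
    rw [pow_one] at h1
    rw [← mul_assoc, ← mul_assoc, h1, smul_mul_assoc, smul_mul_assoc, mul_assoc, mul_assoc]
    refine Submodule.smul_mem _ _ (h_mul_mem _ ?_)
    induction j with
    | zero => exact Submodule.subset_span ⟨0, 0, l + 1, by simp [pow_succ']⟩
    | succ j ih =>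
      have h2 : a₂ * (a₁ ^ (j + 1) * a₂ ^ l) = q • (a₁ * (a₂ * (a₁ ^ j * a₂ ^ l))) +
          lam • (a₁ ^ j * a₂ ^ l - h ^ 2 * (a₁ ^ j * a₂ ^ l)) := by
        have h3 : a₂ * a₁ = q • (a₁ * a₂) + lam • (1 - h ^ 2) := by rw [← H.a₂_a₁]; abel
        rw [pow_succ', mul_assoc, ← mul_assoc, h3, add_mul, smul_mul_assoc, smul_mul_assoc,
          sub_mul, one_mul, mul_assoc]
      have h4 : a₁ ^ j * a₂ ^ l ∈
          Submodule.span k {x | ∃ i j l : ℕ, x = h ^ i * a₁ ^ j * a₂ ^ l} :=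
        Submodule.subset_span ⟨0, j, l, by simp⟩
      rw [h2]
      exact Submodule.add_mem _ (Submodule.smul_mem _ _ (H.a₁_mul_mem hq ih))
        (Submodule.smul_mem _ _ (Submodule.sub_mem _ h4 (h_mul_mem 2 h4)))
  | zero => simp
  | add x y _ _ hx hy => rw [mul_add]; exact Submodule.add_mem _ hx hy
  | smul a x _ hx => rw [mul_smul_comm]; exact Submodule.smul_mem _ _ hx

/-- The span of the ordered monomials contains 1 and is stable under left multiplication by the
generators. -/
lemma span_eq_top (H : Relations M N q lam h a₁ a₂) (hq : q ≠ 0)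
    (hgen : Algebra.adjoin k {h, a₁, a₂} = ⊤) :
    Submodule.span k {x | ∃ i j l : ℕ, x = h ^ i * a₁ ^ j * a₂ ^ l} = ⊤ := by
  rw [eq_top_iff]
  rintro x -
  have hx : x ∈ Algebra.adjoin k {h, a₁, a₂} := hgen ▸ trivial
  suffices hmul : ∀ y ∈ Submodule.span k {x | ∃ i j l : ℕ, x = h ^ i * a₁ ^ j * a₂ ^ l},
      x * y ∈ Submodule.span k {x | ∃ i j l : ℕ, x = h ^ i * a₁ ^ j * a₂ ^ l} by
    simpa using hmul 1 (Submodule.subset_span ⟨0, 0, 0, by simp⟩)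
  induction hx using Algebra.adjoin_induction with
  | mem x hx =>
    intro y hy
    rcases hx with rfl | rfl | rfl
    · simpa using h_mul_mem 1 hy
    · exact H.a₁_mul_mem hq hy
    · exact H.a₂_mul_mem hq hy
  | algebraMap r =>
    intro y hy
    rw [← Algebra.smul_def]
    exact Submodule.smul_mem _ _ hy
  | add x y _ _ hx hy =>
    intro z hz
    rw [add_mul]
    exact Submodule.add_mem _ (hx z hz) (hy z hz)
  | mul x y _ _ hx hy =>
    intro z hz
    rw [mul_assoc]
    exact hx _ (hy z hz)

lemma commute_h_pow_a₁ (H : Relations M N q lam h a₁ a₂) (hqN : q ^ N = 1) :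
    Commute (h ^ N) a₁ := by
  rw [Commute, SemiconjBy, pow_mul_of_qcomm H.h_a₁, hqN, one_smul]

/-- Monomials reduce to restricted ones without raising the degree. -/
lemma pow_mul_pow_mul_pow_mem (H : Relations M N q lam h a₁ a₂) [NeZero (M * N)]
    (hqN : q ^ N = 1) (i j l : ℕ) :
    h ^ i * a₁ ^ j * a₂ ^ l ∈
      Submodule.span k (monomial (M * N) h a₁ a₂ '' monomialIndex (M * N) N (j + l)) := by
  obtain ⟨d, hd⟩ : ∃ d, j + l = d := ⟨_, rfl⟩
  rw [hd]
  have hN : 0 < N := Nat.pos_of_ne_zero fun h0 ↦ NeZero.ne (M * N) (by simp [h0])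
  induction d using Nat.strong_induction_on generalizing i j l with
  | _ d ih =>
  have step : ∀ i' j' l', j' + l' < d → h ^ i' * a₁ ^ j' * a₂ ^ l' ∈
      Submodule.span k (monomial (M * N) h a₁ a₂ '' monomialIndex (M * N) N d) :=
    fun i' j' l' hlt ↦ Submodule.span_mono
      (Set.image_mono (monomialIndex_mono _ _ hlt.le)) (ih _ hlt i' j' l' rfl)
  by_cases hj : N ≤ j
  · obtain ⟨j, rfl⟩ := Nat.exists_eq_add_of_le hj
    have h1 : h ^ i * a₁ ^ (N + j) * a₂ ^ l =
        h ^ i * a₁ ^ j * a₂ ^ l - h ^ (i + N) * a₁ ^ j * a₂ ^ l := by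
      rw [pow_add, H.a₁_pow, pow_add]
      noncomm_ring
    rw [h1]
    exact Submodule.sub_mem _ (step _ _ _ (by omega)) (step _ _ _ (by omega))
  by_cases hl : N ≤ l
  · obtain ⟨l, rfl⟩ := Nat.exists_eq_add_of_le hl
    -- Since q^N = 1, h^N commutes with a₁, so the factor 1 - h^N replacing a₂^N can be moved to the
    -- left.
    have h1 : h ^ i * a₁ ^ j * a₂ ^ (N + l) =
        h ^ i * a₁ ^ j * a₂ ^ l - h ^ (i + N) * a₁ ^ j * a₂ ^ l := by
      rw [pow_add a₂, H.a₂_pow, pow_add, mul_assoc (h ^ i) (h ^ N),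
        ((H.commute_h_pow_a₁ hqN).pow_right j).eq]
      noncomm_ring
    rw [h1]
    exact Submodule.sub_mem _ (step _ _ _ (by omega)) (step _ _ _ (by omega))
  · refine Submodule.subset_span ⟨((i : ZMod (M * N)), j, l), ⟨?_, ?_, ?_⟩, ?_⟩
    · dsimp only; omega
    · dsimp only; omega
    · dsimp only; omega
    · have h1 := pow_val_add_natCast H.h_pow' (0 : ZMod (M * N)) i
      rw [zero_add, ZMod.val_zero, pow_zero, one_mul] at h1
      simp only [monomial, h1]

lemma span_monomial_eq (H : Relations M N q lam h a₁ a₂) [NeZero (M * N)]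
    (hqN : q ^ N = 1) (d : ℕ) :
    Submodule.span k (monomial (M * N) h a₁ a₂ '' monomialIndex (M * N) N d) =
      Submodule.span k {x | ∃ i j₁ j₂ : ℕ, i ≤ N * M ∧ j₁ + j₂ ≤ d ∧
        x = h ^ i * a₁ ^ j₁ * a₂ ^ j₂} := by
  apply le_antisymm
  · refine Submodule.span_mono ?_
    rintro _ ⟨z, hz, rfl⟩
    exact ⟨_, _, _, (ZMod.val_lt z.1).le.trans_eq (mul_comm M N), hz.2.2, rfl⟩
  · rw [Submodule.span_le]
    rintro _ ⟨i, j, l, -, hjl, rfl⟩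
    exact Submodule.span_mono (Set.image_mono (monomialIndex_mono _ _ hjl))
      (H.pow_mul_pow_mul_pow_mem hqN i j l)

lemma span_monomial_eq_top (H : Relations M N q lam h a₁ a₂) [NeZero (M * N)]
    (hq : q ≠ 0) (hqN : q ^ N = 1) (hgen : Algebra.adjoin k {h, a₁, a₂} = ⊤) :
    Submodule.span k (monomial (M * N) h a₁ a₂ '' monomialIndex (M * N) N (2 * N)) = ⊤ := by
  rw [eq_top_iff, ← H.span_eq_top hq hgen, Submodule.span_le]
  rintro _ ⟨i, j, l, rfl⟩
  refine Submodule.span_mono (Set.image_mono ?_) (H.pow_mul_pow_mul_pow_mem hqN i j l)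
  rintro z ⟨h1, h2, -⟩
  exact ⟨h1, h2, by omega⟩

end Algebra

/-! ### Comultiplication of monomials and independence in degree at most one -/

section Bialgebra

variable {k A : Type*} [Field k] [Ring A] [Bialgebra k A] {M N : ℕ} {q lam : k} {h a₁ a₂ : A}

lemma comul_pow_of_skewPrimitive {h a : A} {q : k} (hcomm : h * a = q • (a * h))
    (ha : Coalgebra.comul (R := k) a = a ⊗ₜ 1 + h ⊗ₜ a) (i : ℕ) :
    Coalgebra.comul (R := k) (a ^ i) = ∑ p ∈ Finset.HasAntidiagonal.antidiagonal i,
      gaussBinom q p.1 p.2 • ((a ^ p.1 * h ^ p.2) ⊗ₜ (a ^ p.2)) := by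
  have hc : (h ⊗ₜ[k] a) * (a ⊗ₜ[k] (1 : A)) = q • ((a ⊗ₜ[k] (1 : A)) * (h ⊗ₜ[k] a)) := by
    simp [hcomm, TensorProduct.smul_tmul']
  rw [Bialgebra.comul_pow, ha, add_pow_of_qcomm hc]
  simp [Algebra.TensorProduct.tmul_pow]

/-- The product of two q-binomial expansions, for q and q⁻¹, with all powers of h moved to the left.
That reordering contributes only powers of q, so the coefficients stay nonzero for exponents below
N. -/
lemma isQuantumPlaneComul (H : Relations M N q lam h a₁ a₂) [NeZero (M * N)]
    (hq : IsPrimitiveRoot q N) (hh : IsGroupLikeElem k h)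
    (h₁ : Coalgebra.comul (R := k) a₁ = a₁ ⊗ₜ 1 + h ⊗ₜ a₁)
    (h₂ : Coalgebra.comul (R := k) a₂ = a₂ ⊗ₜ 1 + h ⊗ₜ a₂) :
    IsQuantumPlaneComul N (fun p s ↦ gaussBinom q p.1 p.2 * gaussBinom q⁻¹ s.1 s.2 *
      (q⁻¹ ^ (p.2 * p.1) * q ^ (s.2 * s.1) * q⁻¹ ^ (s.2 * p.1)))
      (monomial (M * N) h a₁ a₂) where
  comul l i j _ _ := by
    have hN : N ≠ 0 := fun h0 ↦ NeZero.ne (M * N) (by simp [h0])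
    have hq0 : q ≠ 0 := hq.ne_zero hN
    simp only [monomial]
    rw [Bialgebra.comul_mul, Bialgebra.comul_mul, comul_pow_of_skewPrimitive H.h_a₁ h₁,
      comul_pow_of_skewPrimitive H.h_a₂ h₂, Bialgebra.comul_pow, hh.comul_eq_tmul_self,
      Algebra.TensorProduct.tmul_pow, mul_assoc, Finset.sum_mul_sum, Finset.mul_sum]
    refine Finset.sum_congr rfl fun p _ ↦ ?_
    rw [Finset.mul_sum]
    refine Finset.sum_congr rfl fun s _ ↦ ?_
    have e1 : h ^ l.val * (a₁ ^ p.1 * h ^ p.2) * (a₂ ^ s.1 * h ^ s.2) =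
        (q⁻¹ ^ (p.2 * p.1) * q ^ (s.2 * s.1) * q⁻¹ ^ (s.2 * p.1)) •
          (h ^ (l + p.2 + s.2).val * a₁ ^ p.1 * a₂ ^ s.1) := by
      rw [H.a₁_pow_mul_h_pow hq0, H.a₂_pow_mul_h_pow hq0, pow_val_add_natCast H.h_pow',
        pow_val_add_natCast H.h_pow']
      have e2 := H.a₁_pow_mul_h_pow hq0 p.1 s.2
      calc h ^ l.val * (q⁻¹ ^ (p.2 * p.1) • (h ^ p.2 * a₁ ^ p.1)) *
            (q ^ (s.2 * s.1) • (h ^ s.2 * a₂ ^ s.1))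
          = (q⁻¹ ^ (p.2 * p.1) * q ^ (s.2 * s.1)) •
            (h ^ l.val * h ^ p.2 * (a₁ ^ p.1 * h ^ s.2) * a₂ ^ s.1) := by
              simp only [mul_smul_comm, smul_mul_assoc, smul_smul, mul_assoc]
              rw [mul_comm (q ^ (s.2 * s.1))]
        _ = _ := by
              rw [e2]
              simp only [mul_smul_comm, smul_mul_assoc, smul_smul, mul_assoc]
    rw [← mul_assoc, mul_smul_comm, mul_smul_comm, smul_mul_assoc, smul_smul,
      mul_comm (gaussBinom q⁻¹ _ _), Algebra.TensorProduct.tmul_mul_tmul, Algebra.TensorProduct.tmul_mul_tmul, e1,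
      ← TensorProduct.smul_tmul', smul_smul]
  ne_zero p s hp hs := by
    have hN : N ≠ 0 := fun h0 ↦ NeZero.ne (M * N) (by simp [h0])
    have hq0 : q ≠ 0 := hq.ne_zero hN
    exact mul_ne_zero (mul_ne_zero (hq.gaussBinom_ne_zero hp) (hq.inv.gaussBinom_ne_zero hs))
      (by simp [hq0])
  isGroupLikeElem l := by simpa [monomial] using hh.pow

lemma linearIndependent_pow_val [NeZero (M * N)] (hh : IsGroupLikeElem k h)
    (hord : orderOf h = M * N) :
    LinearIndependent k fun l : ZMod (M * N) ↦ h ^ l.val := by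
  refine (linearIndep_groupLikeVal (R := k) (A := A)).comp
    (fun l : ZMod (M * N) ↦ ⟨h ^ l.val, hh.pow⟩) fun l m hlm ↦ ?_
  refine ZMod.val_injective _ (pow_injOn_Iio_orderOf ?_ ?_ (GroupLike.ext_iff.1 hlm))
  · rw [hord]; exact ZMod.val_lt l
  · rw [hord]; exact ZMod.val_lt m

lemma coeff_eq_zero_of_sum_pow_eq_zero [NeZero (M * N)] (hh : IsGroupLikeElem k h)
    (hord : orderOf h = M * N) {f : ZMod (M * N) → k} (hf : ∑ l, f l • h ^ l.val = 0)
    (l : ZMod (M * N)) : f l = 0 := by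
  have h1 : LinearIndependent k fun l : ZMod (M * N) ↦ h ^ l.val :=
    linearIndependent_pow_val hh hord
  rw [Fintype.linearIndependent_iff] at h1
  exact h1 f hf l

/-- The translates of a skew-primitive element by powers of `h` are linearly independent. -/
lemma coeff_eq_zero_of_sum_mul_eq_zero [NeZero (M * N)] (hh : IsGroupLikeElem k h)
    (hord : orderOf h = M * N) {a : A} {ζ : k} (hζ : ζ ≠ 1) (hcomm : h * a = ζ • (a * h))
    (ha : Coalgebra.comul (R := k) a = a ⊗ₜ 1 + h ⊗ₜ a) (ha0 : a ≠ 0) {f : ZMod (M * N) → k}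
    (hf : ∑ l, f l • (h ^ l.val * a) = 0) (l : ZMod (M * N)) : f l = 0 := by
  have hu : IsUnit h := IsUnit.of_pow_eq_one (hord ▸ pow_orderOf_eq_one h) (NeZero.ne (M * N))
  -- Slicing by the functional dual to h^l leaves f(l) h^l a plus a combination y of powers of h.
  -- Since y commutes with h while h^l a is an eigenvector with eigenvalue ζ ≠ 1, both parts vanish.
  obtain ⟨ψ, hψ⟩ := (linearIndepOn_univ_iff.2 (linearIndependent_pow_val (k := k) hh hord)).exists_dual
    (Set.mem_univ l)
  have h1 := congrArg (fun x ↦ sliceRight ψ (Coalgebra.comul (R := k) x)) hf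
  simp only [map_sum, map_smul, map_zero, Bialgebra.comul_mul, Bialgebra.comul_pow,
    hh.comul_eq_tmul_self, ha, mul_add, Algebra.TensorProduct.tmul_pow,
    Algebra.TensorProduct.tmul_mul_tmul, mul_one, map_add, sliceRight_tmul, hψ _ (Set.mem_univ _),
    smul_add, Finset.sum_add_distrib] at h1
  rw [Finset.sum_eq_single l (fun m _ hm ↦ by rw [if_neg hm, zero_smul, smul_zero]) (by simp),
    if_pos rfl, one_smul] at h1
  set y := ∑ m : ZMod (M * N), f m • ψ (h ^ m.val * a) • (h ^ m.val * h) with hy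
  have hyc : h * y = y * h := by
    rw [hy, Finset.mul_sum, Finset.sum_mul]
    refine Finset.sum_congr rfl fun m _ ↦ ?_
    rw [mul_smul_comm, mul_smul_comm, smul_mul_assoc, smul_mul_assoc, ← mul_assoc, ← pow_succ',
      pow_succ]
  have hz : f l • (h ^ l.val * a) = - y := eq_neg_of_add_eq_zero_left h1
  have hzc : h * (f l • (h ^ l.val * a)) = ζ • ((f l • (h ^ l.val * a)) * h) := by
    rw [mul_smul_comm, ← mul_assoc, ← pow_succ', pow_succ, mul_assoc, hcomm, mul_smul_comm,
      smul_comm, smul_mul_assoc, mul_assoc]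
  have hzc' : h * (f l • (h ^ l.val * a)) = (f l • (h ^ l.val * a)) * h := by
    rw [hz, mul_neg, neg_mul, hyc]
  rw [hzc', ← sub_eq_zero, ← one_smul k (f l • (h ^ l.val * a) * h), smul_smul, mul_one,
    ← sub_smul, smul_eq_zero, hu.mul_left_eq_zero, smul_eq_zero,
    (hu.pow _).mul_right_eq_zero] at hzc
  rcases hzc with h2 | h2 | h2
  · exact absurd (sub_eq_zero.1 h2).symm hζ
  · exact h2
  · exact absurd h2 ha0

/-- Otherwise h^N = 1, although the order MN of h exceeds N because M > 1. -/
lemma a₁_ne_zero (H : Relations M N q lam h a₁ a₂) (hM : 1 < M) (hN : 0 < N)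
    (hord : orderOf h = M * N) : a₁ ≠ 0 := by
  intro h0
  have h1 := H.a₁_pow
  rw [h0, zero_pow hN.ne', eq_comm, sub_eq_zero, eq_comm] at h1
  have := Nat.le_of_dvd hN (orderOf_dvd_of_pow_eq_one h1)
  rw [hord] at this
  nlinarith

lemma a₂_ne_zero (H : Relations M N q lam h a₁ a₂) (hM : 1 < M) (hN : 0 < N)
    (hord : orderOf h = M * N) : a₂ ≠ 0 := by
  intro h0
  have h1 := H.a₂_pow
  rw [h0, zero_pow hN.ne', eq_comm, sub_eq_zero, eq_comm] at h1
  have := Nat.le_of_dvd hN (orderOf_dvd_of_pow_eq_one h1)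
  rw [hord] at this
  nlinarith

lemma _root_.IsPrimitiveRoot.ne_inv {q : k} (hq : IsPrimitiveRoot q N) (hN : 2 < N) :
    q ≠ q⁻¹ := by
  intro h0
  have hq0 : q ≠ 0 := hq.ne_zero (by omega)
  refine hq.pow_ne_one_of_pos_of_lt two_ne_zero hN ?_
  rw [pow_two]
  nth_rewrite 2 [h0]
  exact mul_inv_cancel₀ hq0

/-- Eigenvectors for the conjugation by `h` with eigenvalues `1`, `q`, `q⁻¹` are independent. -/
lemma eq_zero_of_add_add_eq_zero (hu : IsUnit h) (hq1 : q ≠ 1) (hqq : q ≠ q⁻¹)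
    {x₀ x₁ x₂ : A} (hc₀ : h * x₀ = x₀ * h) (hc₁ : h * x₁ = q • (x₁ * h))
    (hc₂ : h * x₂ = q⁻¹ • (x₂ * h)) (hsum : x₀ + x₁ + x₂ = 0) : x₀ = 0 ∧ x₁ = 0 ∧ x₂ = 0 := by
  have hqi1 : q⁻¹ ≠ 1 := by simpa using hq1
  have conj : ∀ r s t : k, r • x₀ + s • x₁ + t • x₂ = 0 →
      r • x₀ + (s * q) • x₁ + (t * q⁻¹) • x₂ = 0 := by
    intro r s t h0
    rw [← hu.mul_left_eq_zero]
    have := congrArg (h * ·) h0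
    simp only [mul_add, mul_smul_comm, hc₀, hc₁, hc₂, mul_zero] at this
    simpa only [add_mul, smul_mul_assoc, mul_smul] using this
  have e1 : (1 : k) • x₀ + (1 : k) • x₁ + (1 : k) • x₂ = 0 := by simpa using hsum
  have e2 := conj _ _ _ e1
  have e3 := conj _ _ _ e2
  have hx₁0 : x₁ = 0 := by
    -- Apply the polynomial (X - 1)(X - q⁻¹) in the conjugation by h; it kills x₀ and x₂.
    have : ((q - 1) * (q - q⁻¹)) • x₁ = 0 := by
      linear_combination (norm := module) e3 - (1 + q⁻¹) • e2 + q⁻¹ • e1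
    exact (smul_eq_zero.1 this).resolve_left
      (mul_ne_zero (sub_ne_zero.2 hq1) (sub_ne_zero.2 hqq))
  have hx₂0 : x₂ = 0 := by
    have : ((q⁻¹ - 1) * (q⁻¹ - q)) • x₂ = 0 := by
      linear_combination (norm := module) e3 - (1 + q) • e2 + q • e1
    exact (smul_eq_zero.1 this).resolve_left
      (mul_ne_zero (sub_ne_zero.2 hqi1) (sub_ne_zero.2 hqq.symm))
  exact ⟨by simpa [hx₁0, hx₂0] using hsum, hx₁0, hx₂0⟩

lemma mem_monomialIndex_one {n : ℕ} {l : ZMod n} {i j : ℕ} (hz : (l, i, j) ∈ monomialIndex n N 1) :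
    (i = 0 ∧ j = 0) ∨ (i = 1 ∧ j = 0) ∨ (i = 0 ∧ j = 1) := by
  obtain ⟨-, -, hij⟩ := hz
  dsimp only at hij
  omega

lemma linearCombination_eq {n : ℕ} [NeZero n] {f : ZMod n × ℕ × ℕ →₀ k}
    (hf : f ∈ Finsupp.supported k k (monomialIndex n N 1)) :
    Finsupp.linearCombination k (monomial n h a₁ a₂) f =
      ∑ l : ZMod n, f (l, 0, 0) • h ^ l.val + ∑ l : ZMod n, f (l, 1, 0) • (h ^ l.val * a₁) +
      ∑ l : ZMod n, f (l, 0, 1) • (h ^ l.val * a₂) := by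
  rw [Finsupp.linearCombination_apply, Finsupp.sum_of_support_subset f
    (s := Finset.univ ×ˢ ({(0, 0), (1, 0), (0, 1)} : Finset (ℕ × ℕ))) _ _ (by simp)]
  · rw [Finset.sum_product, ← Finset.sum_add_distrib, ← Finset.sum_add_distrib]
    refine Finset.sum_congr rfl fun l _ ↦ ?_
    rw [Finset.sum_insert (by simp), Finset.sum_insert (by simp), Finset.sum_singleton]
    simp [monomial, add_assoc]
  · rintro ⟨l, i, j⟩ hz
    obtain ⟨rfl, rfl⟩ | ⟨rfl, rfl⟩ | ⟨rfl, rfl⟩ :=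
      mem_monomialIndex_one ((Finsupp.mem_supported k f).1 hf hz)
    all_goals simp

lemma mul_sum_of_qcomm {n : ℕ} [NeZero n] {a : A} {ζ : k} (hcomm : h * a = ζ • (a * h))
    (f : ZMod n → k) :
    h * ∑ l, f l • (h ^ l.val * a) = ζ • ((∑ l, f l • (h ^ l.val * a)) * h) := by
  rw [Finset.mul_sum, Finset.sum_mul, Finset.smul_sum]
  exact Finset.sum_congr rfl fun l _ ↦ by
    rw [mul_smul_comm, smul_mul_assoc, ← mul_assoc, ← pow_succ', pow_succ, mul_assoc, hcomm,
      mul_smul_comm, smul_comm, mul_assoc]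

/-- Conjugation by h separates the three blocks h^l, h^l a₁ and h^l a₂, because 1, q, q⁻¹ are
distinct for N > 2. Each block is then handled through the independence of group-likes. -/
lemma linearIndepOn_one (H : Relations M N q lam h a₁ a₂) [NeZero (M * N)] (hM : 1 < M)
    (hN : 2 < N) (hq : IsPrimitiveRoot q N) (hh : IsGroupLikeElem k h)
    (h₁ : Coalgebra.comul (R := k) a₁ = a₁ ⊗ₜ 1 + h ⊗ₜ a₁)
    (h₂ : Coalgebra.comul (R := k) a₂ = a₂ ⊗ₜ 1 + h ⊗ₜ a₂) (hord : orderOf h = M * N) :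
    LinearIndepOn k (monomial (M * N) h a₁ a₂) (monomialIndex (M * N) N 1) := by
  have hq1 : q ≠ 1 := hq.ne_one (by omega)
  have hqi1 : q⁻¹ ≠ 1 := hq.inv.ne_one (by omega)
  rw [linearIndepOn_iff]
  intro f hf hf0
  rw [linearCombination_eq hf] at hf0
  have hx : h * ∑ l : ZMod (M * N), f (l, 0, 0) • h ^ l.val =
      (∑ l : ZMod (M * N), f (l, 0, 0) • h ^ l.val) * h := by
    simpa using mul_sum_of_qcomm (h := h) (a := 1) (ζ := (1 : k)) (by simp)
      fun l : ZMod (M * N) ↦ f (l, 0, 0)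
  obtain ⟨hx₀, hx₁, hx₂⟩ := eq_zero_of_add_add_eq_zero (H.isUnit_h (NeZero.ne (M * N))) hq1
    (hq.ne_inv hN)
    hx (mul_sum_of_qcomm H.h_a₁ _) (mul_sum_of_qcomm H.h_a₂ _) hf0
  have n₁ : a₁ ≠ 0 := H.a₁_ne_zero hM (by omega) hord
  have n₂ : a₂ ≠ 0 := H.a₂_ne_zero hM (by omega) hord
  have f0 : ∀ l : ZMod (M * N), f (l, 0, 0) = 0 :=
    coeff_eq_zero_of_sum_pow_eq_zero hh hord (f := fun l ↦ f (l, 0, 0)) hx₀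
  have f1 : ∀ l : ZMod (M * N), f (l, 1, 0) = 0 :=
    coeff_eq_zero_of_sum_mul_eq_zero hh hord hq1 H.h_a₁ h₁ n₁ (f := fun l ↦ f (l, 1, 0)) hx₁
  have f2 : ∀ l : ZMod (M * N), f (l, 0, 1) = 0 :=
    coeff_eq_zero_of_sum_mul_eq_zero hh hord hqi1 H.h_a₂ h₂ n₂ (f := fun l ↦ f (l, 0, 1)) hx₂
  ext ⟨l, i, j⟩
  by_cases hz : (l, i, j) ∈ f.support
  · obtain ⟨rfl, rfl⟩ | ⟨rfl, rfl⟩ | ⟨rfl, rfl⟩ :=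
      mem_monomialIndex_one ((Finsupp.mem_supported k f).1 hf hz)
    · exact f0 l
    · exact f1 l
    · exact f2 l
  · exact Finsupp.notMem_support_iff.1 hz

end Bialgebra

end Relations

end LiftedPlane

namespace LiftedPlane

/-! ### Bialgebras generated by a lifted quantum plane -/

/-- A bialgebra generated by elements `h`, `a₁`, `a₂` that satisfy the defining relations, with the
standard comultiplication, where `h` has the maximal order. -/
structure IsLiftedPlane {k A : Type*} [Field k] [Ring A] [Bialgebra k A] (M N : ℕ) (q lam : k)
    (h a₁ a₂ : A) : Prop extends Relations M N q lam h a₁ a₂ where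
  one_lt_M : 1 < M
  two_lt_N : 2 < N
  isPrimitiveRoot : IsPrimitiveRoot q N
  adjoin_eq_top : Algebra.adjoin k {h, a₁, a₂} = ⊤
  isGroupLikeElem : IsGroupLikeElem k h
  comul_a₁ : Coalgebra.comul (R := k) a₁ = a₁ ⊗ₜ 1 + h ⊗ₜ a₁
  comul_a₂ : Coalgebra.comul (R := k) a₂ = a₂ ⊗ₜ 1 + h ⊗ₜ a₂
  orderOf_h : orderOf h = M * N

namespace IsLiftedPlane

section

variable {k A : Type*} [Field k] [Ring A] [Bialgebra k A] {M N : ℕ} {q lam : k} {h a₁ a₂ : A}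

lemma neZero (H : IsLiftedPlane M N q lam h a₁ a₂) : NeZero (M * N) := by
  have h1 := H.one_lt_M
  have h2 := H.two_lt_N
  exact ⟨(Nat.mul_pos (by omega) (by omega)).ne'⟩

lemma ne_zero (H : IsLiftedPlane M N q lam h a₁ a₂) : q ≠ 0 :=
  H.isPrimitiveRoot.ne_zero (by have := H.two_lt_N; omega)

lemma exists_isQuantumPlaneComul (H : IsLiftedPlane M N q lam h a₁ a₂) :
    ∃ c : ℕ × ℕ → ℕ × ℕ → k, IsQuantumPlaneComul N c (monomial (M * N) h a₁ a₂) :=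
  have := H.neZero
  ⟨_, H.isQuantumPlaneComul H.isPrimitiveRoot H.isGroupLikeElem H.comul_a₁ H.comul_a₂⟩

lemma linearIndepOn (H : IsLiftedPlane M N q lam h a₁ a₂) (d : ℕ) :
    LinearIndepOn k (monomial (M * N) h a₁ a₂) (monomialIndex (M * N) N d) := by
  have := H.neZero
  obtain ⟨c, hc⟩ := H.exists_isQuantumPlaneComul
  exact hc.linearIndepOn (H.linearIndepOn_one H.one_lt_M H.two_lt_N H.isPrimitiveRoot
    H.isGroupLikeElem H.comul_a₁ H.comul_a₂ H.orderOf_h) d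

lemma span_eq_top' (H : IsLiftedPlane M N q lam h a₁ a₂) :
    Submodule.span k (monomial (M * N) h a₁ a₂ '' monomialIndex (M * N) N (2 * N)) = ⊤ :=
  have := H.neZero
  H.span_monomial_eq_top H.ne_zero H.isPrimitiveRoot.pow_eq_one H.adjoin_eq_top

theorem finrank_eq (H : IsLiftedPlane M N q lam h a₁ a₂) : Module.finrank k A = M * N ^ 3 := by
  have := H.neZero
  let ι : ZMod (M * N) × Fin N × Fin N → monomialIndex (M * N) N (2 * N) := fun z ↦
    ⟨(z.1, z.2.1, z.2.2), z.2.1.2, z.2.2.2, by dsimp only; omega⟩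
  have hinj : Function.Injective ι := by
    rintro ⟨l, i, j⟩ ⟨l', i', j'⟩ hz
    simpa [ι, Subtype.ext_iff, Fin.ext_iff] using hz
  have hli : LinearIndependent k fun z ↦ monomial (M * N) h a₁ a₂ (ι z) :=
    LinearIndependent.comp (H.linearIndepOn (2 * N)) ι hinj
  have hsp : ⊤ ≤ Submodule.span k (Set.range fun z ↦ monomial (M * N) h a₁ a₂ (ι z)) := by
    rw [← H.span_eq_top']
    refine Submodule.span_mono ?_
    rintro _ ⟨⟨l, i, j⟩, ⟨hi, hj, _⟩, rfl⟩
    exact ⟨(l, ⟨i, hi⟩, ⟨j, hj⟩), rfl⟩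
  rw [Module.finrank_eq_card_basis (Module.Basis.mk hli hsp)]
  simp only [Fintype.card_prod, ZMod.card, Fintype.card_fin]
  ring

theorem isPointedCoalgebra (H : IsLiftedPlane M N q lam h a₁ a₂) : IsPointedCoalgebra k A := by
  obtain ⟨c, hc⟩ := H.exists_isQuantumPlaneComul
  exact hc.isPointedCoalgebra (by have := H.two_lt_N; omega) (H.linearIndepOn 0) H.span_eq_top'

theorem isGroupLikeElem_iff (H : IsLiftedPlane M N q lam h a₁ a₂) (g : A) :
    IsGroupLikeElem k g ↔ ∃ i : ℕ, g = h ^ i := by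
  obtain ⟨c, hc⟩ := H.exists_isQuantumPlaneComul
  constructor
  · intro hg
    obtain ⟨l, rfl⟩ := hc.exists_eq_of_isGroupLikeElem (by have := H.two_lt_N; omega)
      (H.linearIndepOn 0) H.span_eq_top' hg
    exact ⟨l.val, by simp [monomial]⟩
  · rintro ⟨i, rfl⟩
    exact H.isGroupLikeElem.pow

theorem coradicalFiltration_eq (H : IsLiftedPlane M N q lam h a₁ a₂) (n : ℕ) :
    coradicalFiltration k A n = Submodule.span k {x | ∃ i j₁ j₂ : ℕ, i ≤ N * M ∧ j₁ + j₂ ≤ n ∧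
      x = h ^ i * a₁ ^ j₁ * a₂ ^ j₂} := by
  have := H.neZero
  obtain ⟨c, hc⟩ := H.exists_isQuantumPlaneComul
  rw [hc.coradicalFiltration_eq H.linearIndepOn (by have := H.two_lt_N; omega) H.span_eq_top',
    H.span_monomial_eq H.isPrimitiveRoot.pow_eq_one]

lemma monomial_natCast (H : IsLiftedPlane M N q lam h a₁ a₂) (m : ℕ) :
    monomial (M * N) h a₁ a₂ ((m : ZMod (M * N)), 0, 0) = h ^ m := by
  have := H.neZero
  have h1 := pow_val_add_natCast H.h_pow' (0 : ZMod (M * N)) m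
  rw [zero_add, ZMod.val_zero, pow_zero, one_mul] at h1
  simp only [monomial, h1, pow_zero, mul_one]

lemma exists_eq_of_mem_skewPrimitives (H : IsLiftedPlane M N q lam h a₁ a₂) {g x : A}
    (hg : IsGroupLikeElem k g) (hx : x ∈ skewPrimitives k g 1) :
    ∃ α β γ : k, x = α • (1 - g) + β • a₁ + γ • a₂ ∧ (g ≠ h → β = 0 ∧ γ = 0) := by
  have := H.neZero
  obtain ⟨c, hc⟩ := H.exists_isQuantumPlaneComul
  obtain ⟨m, rfl⟩ := (H.isGroupLikeElem_iff g).1 hg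
  have e0 : monomial (M * N) h a₁ a₂ (0, 0, 0) = 1 := by simp [monomial]
  obtain ⟨α, β, γ, hα, hβ⟩ := hc.exists_eq_of_mem_skewPrimitives H.linearIndepOn
    (t := (m : ZMod (M * N))) (x := x) (by have := H.two_lt_N; omega) H.span_eq_top'
    (by rwa [H.monomial_natCast, e0])
  refine ⟨α, β, γ, ?_, fun hne ↦ hβ fun h1 ↦ hne ?_⟩
  · rw [hα, H.monomial_natCast, e0]
    simp [monomial]
  · rw [← H.monomial_natCast, h1]
    simpa using H.monomial_natCast 1

lemma one_sub_mem_skewPrimitives {g : A} (hg : IsGroupLikeElem k g) :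
    1 - g ∈ skewPrimitives k g 1 := by
  change Coalgebra.comul (R := k) (1 - g) = (1 - g) ⊗ₜ 1 + g ⊗ₜ (1 - g)
  rw [map_sub, Bialgebra.comul_one, hg.comul_eq_tmul_self, TensorProduct.sub_tmul,
    TensorProduct.tmul_sub, Algebra.TensorProduct.one_def]
  abel

theorem skewPrimitives_h (H : IsLiftedPlane M N q lam h a₁ a₂) :
    skewPrimitives k h 1 = Submodule.span k {1 - h, a₁, a₂} := by
  apply le_antisymm
  · intro x hx
    obtain ⟨α, β, γ, rfl, -⟩ := H.exists_eq_of_mem_skewPrimitives H.isGroupLikeElem hx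
    exact Submodule.add_mem _ (Submodule.add_mem _
      (Submodule.smul_mem _ _ (Submodule.subset_span (by simp)))
      (Submodule.smul_mem _ _ (Submodule.subset_span (by simp))))
      (Submodule.smul_mem _ _ (Submodule.subset_span (by simp)))
  · rw [Submodule.span_le]
    rintro x (rfl | rfl | rfl)
    · exact one_sub_mem_skewPrimitives H.isGroupLikeElem
    · exact H.comul_a₁
    · exact H.comul_a₂

theorem skewPrimitives_of_ne (H : IsLiftedPlane M N q lam h a₁ a₂) {g : A}
    (hg : IsGroupLikeElem k g) (hne : g ≠ h) :
    skewPrimitives k g 1 = Submodule.span k {1 - g} := by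
  apply le_antisymm
  · intro x hx
    obtain ⟨α, β, γ, rfl, h0⟩ := H.exists_eq_of_mem_skewPrimitives hg hx
    obtain ⟨rfl, rfl⟩ := h0 hne
    exact Submodule.mem_span_singleton.2 ⟨α, by simp⟩
  · rw [Submodule.span_singleton_le_iff_mem]
    exact one_sub_mem_skewPrimitives hg

lemma eq_zero_of_combination_eq_zero (H : IsLiftedPlane M N q lam h a₁ a₂) {α β γ : k}
    (h0 : α • (1 - h) + β • a₁ + γ • a₂ = 0) : α = 0 ∧ β = 0 ∧ γ = 0 := by
  have := H.neZero
  have hN := H.two_lt_N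
  have hM := H.one_lt_M
  have hn1 : (0 : ZMod (M * N)) ≠ 1 := by
    have : Fact (1 < M * N) := ⟨by nlinarith⟩
    exact zero_ne_one
  have e0 : monomial (M * N) h a₁ a₂ (0, 0, 0) = 1 := by simp [monomial]
  have e1 : monomial (M * N) h a₁ a₂ (1, 0, 0) = h := by simpa using H.monomial_natCast 1
  have e2 : monomial (M * N) h a₁ a₂ (0, 1, 0) = a₁ := by simp [monomial]
  have e3 : monomial (M * N) h a₁ a₂ (0, 0, 1) = a₂ := by simp [monomial]
  have m0 : ∀ l : ZMod (M * N), (l, 0, 0) ∈ monomialIndex (M * N) N 1 := fun l ↦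
    ⟨by dsimp only; omega, by dsimp only; omega, by dsimp only; omega⟩
  have m1 : ((0 : ZMod (M * N)), 1, 0) ∈ monomialIndex (M * N) N 1 :=
    ⟨by dsimp only; omega, by dsimp only; omega, by dsimp only; omega⟩
  have m2 : ((0 : ZMod (M * N)), 0, 1) ∈ monomialIndex (M * N) N 1 :=
    ⟨by dsimp only; omega, by dsimp only; omega, by dsimp only; omega⟩
  have h0' : α • (monomial (M * N) h a₁ a₂ (0, 0, 0) - monomial (M * N) h a₁ a₂ (1, 0, 0)) +
      β • monomial (M * N) h a₁ a₂ (0, 1, 0) + γ • monomial (M * N) h a₁ a₂ (0, 0, 1) = 0 := by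
    rw [e0, e1, e2, e3, h0]
  have key : ∀ z ∈ monomialIndex (M * N) N 1,
      α * ((if (0, 0, 0) = z then 1 else 0) - (if (1, 0, 0) = z then 1 else 0)) +
        β * (if (0, 1, 0) = z then 1 else 0) + γ * (if (0, 0, 1) = z then 1 else 0) = 0 := by
    intro z hz
    obtain ⟨φ, hφ⟩ := (H.linearIndepOn 1).exists_dual hz
    have h1 := congrArg φ h0'
    rwa [map_add, map_add, map_smul, map_smul, map_smul, map_sub,
      hφ _ (m0 0), hφ _ (m0 1), hφ _ m1, hφ _ m2, map_zero] at h1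
  exact ⟨by simpa [hn1.symm] using key _ (m0 0), by simpa using key _ m1, by simpa using key _ m2⟩

theorem linearIndependent_skewPrimitives (H : IsLiftedPlane M N q lam h a₁ a₂) :
    LinearIndependent k ![1 - h, a₁, a₂] := by
  rw [Fintype.linearIndependent_iff]
  intro g hg
  rw [Fin.sum_univ_three] at hg
  obtain ⟨h0, h1, h2⟩ := H.eq_zero_of_combination_eq_zero hg
  intro i
  fin_cases i
  exacts [h0, h1, h2]

/-- Needed for m = N and m = 2: the right-hand sides of the power relations and of the last relation
are nonzero multiples, so scalars can be compared there. -/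
lemma h_pow_ne_one (H : IsLiftedPlane M N q lam h a₁ a₂) {m : ℕ} (hm : 0 < m) (hmN : m ≤ N) :
    (1 : A) - h ^ m ≠ 0 := by
  intro h0
  have h1 := Nat.le_of_dvd hm (orderOf_dvd_of_pow_eq_one (sub_eq_zero.1 h0).symm)
  rw [H.orderOf_h] at h1
  have hN := H.two_lt_N
  have hM := H.one_lt_M
  nlinarith

end

/-! ### Isomorphisms between lifted quantum planes -/

section Isomorphism

variable {k A A' : Type*} [Field k] [Ring A] [Bialgebra k A] [Ring A'] [Bialgebra k A']
  {M N : ℕ} {q lam lam' : k} {h a₁ a₂ : A} {h' a₁' a₂' : A'}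

lemma map_mem_skewPrimitives (e : A ≃ₐc[k] A') {g x : A} (hx : x ∈ skewPrimitives k g 1) :
    e x ∈ skewPrimitives k (e g) 1 := by
  have h1 : Coalgebra.comul (R := k) x = x ⊗ₜ 1 + g ⊗ₜ x := hx
  have h2 := CoalgHomClass.map_comp_comul_apply e x
  rw [h1] at h2
  change Coalgebra.comul (R := k) (e x) = e x ⊗ₜ 1 + e g ⊗ₜ e x
  rw [← h2, map_add, TensorProduct.map_tmul, TensorProduct.map_tmul]
  change e x ⊗ₜ[k] e 1 + e g ⊗ₜ[k] e x = _
  rw [map_one]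

/-- Only h carries skew-primitives beyond the trivial ones. If h were sent elsewhere, the image of
a₁ would be trivial, and a₁ would be a multiple of 1 - h. -/
lemma map_h (H : IsLiftedPlane M N q lam h a₁ a₂) (H' : IsLiftedPlane M N q lam' h' a₁' a₂')
    (e : A ≃ₐc[k] A') : e h = h' := by
  by_contra hne
  have h1 := map_mem_skewPrimitives e (x := a₁) H.comul_a₁
  rw [H'.skewPrimitives_of_ne (H.isGroupLikeElem.map e) hne] at h1
  obtain ⟨α, hα⟩ := Submodule.mem_span_singleton.1 h1
  have h2 : e (α • (1 - h)) = e a₁ := by rw [map_smul, map_sub, map_one, hα]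
  have h3 : α • (1 - h) + (-1 : k) • a₁ + (0 : k) • a₂ = 0 := by
    rw [EquivLike.injective e h2]
    simp
  exact neg_ne_zero.2 one_ne_zero (H.eq_zero_of_combination_eq_zero h3).2.1

/-- A skew-primitive eigenvector for the conjugation by `h`. -/
lemma coeff_eq_zero_of_eigenvector (H : IsLiftedPlane M N q lam h a₁ a₂) {ζ α β γ : k}
    (hx : h * (α • (1 - h) + β • a₁ + γ • a₂) = ζ • ((α • (1 - h) + β • a₁ + γ • a₂) * h)) :
    α * (1 - ζ) = 0 ∧ β * (q - ζ) = 0 ∧ γ * (q⁻¹ - ζ) = 0 := by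
  have := H.neZero
  have hu : IsUnit h := H.isUnit_h (NeZero.ne (M * N))
  refine H.eq_zero_of_combination_eq_zero ?_
  rw [← hu.mul_left_eq_zero]
  simp only [mul_add, mul_smul_comm, H.h_a₁, H.h_a₂, mul_sub, mul_one, add_mul, smul_mul_assoc,
    sub_mul, one_mul] at hx ⊢
  linear_combination (norm := module) hx

/-- Within the three-dimensional space of skew-primitives, 1 - h, a₁, a₂ have distinct eigenvalues
under conjugation by h, so a₁ ↦ αa₁' and a₂ ↦ βa₂'. The power relations give α^N = β^N = 1, and the
last relation gives αβλ' = λ. -/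
theorem exists_eq_mul_of_equiv (H : IsLiftedPlane M N q lam h a₁ a₂)
    (H' : IsLiftedPlane M N q lam' h' a₁' a₂') (e : A ≃ₐc[k] A') :
    ∃ u : k, u ^ N = 1 ∧ lam' = u * lam := by
  have hh := H.map_h H' e
  have hN := H.two_lt_N
  have hq1 : q ≠ 1 := H.isPrimitiveRoot.ne_one (by omega)
  have hqi1 : q⁻¹ ≠ 1 := H.isPrimitiveRoot.inv.ne_one (by omega)
  have hqq := H.isPrimitiveRoot.ne_inv hN
  have hprim : ∀ x ∈ skewPrimitives k h 1, e x ∈ skewPrimitives k h' 1 := fun x hx ↦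
    hh ▸ map_mem_skewPrimitives e hx
  obtain ⟨α, ha₁⟩ : ∃ α : k, e a₁ = α • a₁' := by
    obtain ⟨x, α, β, hx, -⟩ := H'.exists_eq_of_mem_skewPrimitives H'.isGroupLikeElem
      (hprim a₁ H.comul_a₁)
    have h1 := congrArg e H.h_a₁
    rw [map_smul, map_mul, map_mul, hh, hx] at h1
    obtain ⟨h2, -, h3⟩ := H'.coeff_eq_zero_of_eigenvector h1
    have hx0 := (mul_eq_zero.1 h2).resolve_right (sub_ne_zero.2 hq1.symm)
    have hβ0 := (mul_eq_zero.1 h3).resolve_right (sub_ne_zero.2 hqq.symm)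
    exact ⟨α, by rw [hx, hx0, hβ0]; simp⟩
  obtain ⟨β, ha₂⟩ : ∃ β : k, e a₂ = β • a₂' := by
    obtain ⟨x, α, β, hx, -⟩ := H'.exists_eq_of_mem_skewPrimitives H'.isGroupLikeElem
      (hprim a₂ H.comul_a₂)
    have h1 := congrArg e H.h_a₂
    rw [map_smul, map_mul, map_mul, hh, hx] at h1
    obtain ⟨h2, h3, -⟩ := H'.coeff_eq_zero_of_eigenvector h1
    have hx0 := (mul_eq_zero.1 h2).resolve_right (sub_ne_zero.2 hqi1.symm)
    have hα0 := (mul_eq_zero.1 h3).resolve_right (sub_ne_zero.2 hqq)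
    exact ⟨β, by rw [hx, hx0, hα0]; simp⟩
  have hα : α ^ N = 1 := by
    have h1 := congrArg e H.a₁_pow
    rw [map_pow, map_sub, map_one, map_pow, hh, ha₁, smul_pow, H'.a₁_pow, ← sub_eq_zero] at h1
    nth_rewrite 2 [← one_smul k (1 - h' ^ N)] at h1
    rw [← sub_smul, smul_eq_zero] at h1
    exact sub_eq_zero.1 (h1.resolve_right (H'.h_pow_ne_one (by omega) le_rfl))
  have hβ : β ^ N = 1 := by
    have h1 := congrArg e H.a₂_pow
    rw [map_pow, map_sub, map_one, map_pow, hh, ha₂, smul_pow, H'.a₂_pow, ← sub_eq_zero] at h1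
    nth_rewrite 2 [← one_smul k (1 - h' ^ N)] at h1
    rw [← sub_smul, smul_eq_zero] at h1
    exact sub_eq_zero.1 (h1.resolve_right (H'.h_pow_ne_one (by omega) le_rfl))
  have hlam : α * β * lam' = lam := by
    have h1 := congrArg e H.a₂_a₁
    rw [map_sub, map_smul, map_mul, map_mul, map_smul, map_sub, map_one, map_pow, hh, ha₁,
      ha₂] at h1
    have h2 : (α * β * lam' - lam) • (1 - h' ^ 2) = 0 := by
      have h3 := H'.a₂_a₁
      simp only [smul_mul_assoc, mul_smul_comm] at h1
      linear_combination (norm := module) h1 - (α * β) • h3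
    exact sub_eq_zero.1 ((smul_eq_zero.1 h2).resolve_right
      (H'.h_pow_ne_one two_pos hN.le))
  have hαβ : (α * β) ^ N = 1 := by rw [mul_pow, hα, hβ, mul_one]
  have hne : α * β ≠ 0 := by
    intro h0
    rw [h0, zero_pow (by omega)] at hαβ
    exact zero_ne_one hαβ
  exact ⟨(α * β)⁻¹, by rw [inv_pow, hαβ, inv_one], by rw [← hlam, inv_mul_cancel_left₀ hne]⟩

end Isomorphism

end IsLiftedPlane

end LiftedPlane

namespace LiftedPlane

/-! ### The universal property of `B(M, N, q, λ)` -/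

section Lift

variable {k : Type*} [Field k] {M N : ℕ} {q lam : k}

variable (M N q lam) in
lemma relations_gen : Relations M N q lam (h M N q lam) (a₁ M N q lam) (a₂ M N q lam) where
  h_pow := by simpa [gen] using RingQuot.mkAlgHom_rel k (Rel.h_pow (M := M) (N := N) (q := q) (lam := lam))
  h_a₁ := by simpa [gen] using RingQuot.mkAlgHom_rel k (Rel.h_a₁ (M := M) (N := N) (q := q) (lam := lam))
  h_a₂ := by simpa [gen] using RingQuot.mkAlgHom_rel k (Rel.h_a₂ (M := M) (N := N) (q := q) (lam := lam))
  a₁_pow := by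
    simpa [gen] using RingQuot.mkAlgHom_rel k (Rel.a₁_pow (M := M) (N := N) (q := q) (lam := lam))
  a₂_pow := by
    simpa [gen] using RingQuot.mkAlgHom_rel k (Rel.a₂_pow (M := M) (N := N) (q := q) (lam := lam))
  a₂_a₁ := by
    simpa [gen] using RingQuot.mkAlgHom_rel k (Rel.a₂_a₁ (M := M) (N := N) (q := q) (lam := lam))

variable {A : Type*} [Ring A] [Algebra k A]

/-- The images of the generators under a homomorphism to be constructed. -/
def genMap (x y z : A) : Gen → A
  | Gen.h => x
  | Gen.a₁ => y
  | Gen.a₂ => z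

/-- The algebra homomorphism defined by elements that satisfy the relations. -/
noncomputable def lift {x y z : A} (H : Relations M N q lam x y z) : B M N q lam →ₐ[k] A :=
  RingQuot.liftAlgHom k ⟨FreeAlgebra.lift k (genMap x y z), by
    rintro _ _ (_ | _ | _ | _ | _ | _)
    · simpa [genMap] using H.h_pow
    · simpa [genMap] using H.h_a₁
    · simpa [genMap] using H.h_a₂
    · simpa [genMap] using H.a₁_pow
    · simpa [genMap] using H.a₂_pow
    · simpa [genMap] using H.a₂_a₁⟩

@[simp] lemma lift_h {x y z : A} (H : Relations M N q lam x y z) : lift H (h M N q lam) = x := by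
  simp [lift, gen, genMap]

@[simp] lemma lift_a₁ {x y z : A} (H : Relations M N q lam x y z) : lift H (a₁ M N q lam) = y := by
  simp [lift, gen, genMap]

@[simp] lemma lift_a₂ {x y z : A} (H : Relations M N q lam x y z) : lift H (a₂ M N q lam) = z := by
  simp [lift, gen, genMap]

lemma algHom_ext {A : Type*} [Semiring A] [Algebra k A] {f g : B M N q lam →ₐ[k] A} (e₀ : f (h M N q lam) = g (h M N q lam))
    (e₁ : f (a₁ M N q lam) = g (a₁ M N q lam)) (e₂ : f (a₂ M N q lam) = g (a₂ M N q lam)) :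
    f = g := by
  apply RingQuot.ringQuot_ext'
  apply FreeAlgebra.hom_ext
  funext x
  cases x
  exacts [e₀, e₁, e₂]

variable (M N q lam) in
lemma adjoin_gen : Algebra.adjoin k {h M N q lam, a₁ M N q lam, a₂ M N q lam} = ⊤ := by
  have h1 := congrArg (Subalgebra.map (RingQuot.mkAlgHom k (Rel M N q lam)))
    (FreeAlgebra.adjoin_range_ι k Gen)
  rw [AlgHom.map_adjoin, Algebra.map_top,
    (AlgHom.range_eq_top _).2 (RingQuot.mkAlgHom_surjective k _)] at h1
  rw [← h1]
  congr 1
  ext y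
  constructor
  · rintro (rfl | rfl | rfl)
    exacts [⟨_, ⟨Gen.h, rfl⟩, rfl⟩, ⟨_, ⟨Gen.a₁, rfl⟩, rfl⟩, ⟨_, ⟨Gen.a₂, rfl⟩, rfl⟩]
  · rintro ⟨_, ⟨(_ | _ | _), rfl⟩, rfl⟩
    exacts [Or.inl rfl, Or.inr (Or.inl rfl), Or.inr (Or.inr rfl)]

end Lift

/-! ### A representation in which `h` has maximal order -/

section Representation

variable {k : Type*} [Field k] {N : ℕ}

/-- Multiplication by a function on `ZMod N`. -/
def mulOp (g : ZMod N → k) : Module.End k (ZMod N → k) where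
  toFun f i := g i * f i
  map_add' _ _ := by ext; simp [mul_add]
  map_smul' _ _ := by ext; simp [mul_left_comm]

/-- The weighted shift `f ↦ (i ↦ g i * f (i + t))`. -/
def shiftOp (t : ZMod N) (g : ZMod N → k) : Module.End k (ZMod N → k) where
  toFun f i := g i * f (i + t)
  map_add' _ _ := by ext; simp [mul_add]
  map_smul' _ _ := by ext; simp [mul_left_comm]

lemma mulOp_pow_apply (g : ZMod N → k) (n : ℕ) (f : ZMod N → k) (i : ZMod N) :
    (mulOp g ^ n) f i = g i ^ n * f i := by
  induction n with
  | zero => simp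
  | succ n ih =>
    rw [pow_succ', Module.End.mul_apply]
    change g i * (mulOp g ^ n) f i = _
    rw [ih]
    ring

lemma shiftOp_pow_apply (t : ZMod N) (g : ZMod N → k) (n : ℕ) (f : ZMod N → k) (i : ZMod N) :
    (shiftOp t g ^ n) f i = (∏ j ∈ Finset.range n, g (i + j * t)) * f (i + n * t) := by
  induction n generalizing i with
  | zero => simp
  | succ n ih =>
    rw [pow_succ', Module.End.mul_apply]
    change g i * (shiftOp t g ^ n) f (i + t) = _
    rw [ih, Finset.prod_range_succ', ← mul_assoc, mul_comm (g i)]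
    congr 1
    · congr 1
      · refine Finset.prod_congr rfl fun j _ ↦ ?_
        congr 1
        push_cast
        ring
      · simp
    · congr 1
      push_cast
      ring

lemma prod_range_eq_prod_zmod [NeZero N] (g : ZMod N → k) (i : ZMod N) :
    ∏ j ∈ Finset.range N, g (i + j) = ∏ x, g x := by
  have hinj : Function.Injective fun j : Fin N ↦ i + ((j : ℕ) : ZMod N) := by
    intro j j' hj
    have h1 := (ZMod.natCast_eq_natCast_iff' _ _ N).1 (add_left_cancel hj)
    rw [Nat.mod_eq_of_lt j.2, Nat.mod_eq_of_lt j'.2] at h1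
    exact Fin.ext h1
  have hbij := (Fintype.bijective_iff_injective_and_card _).2 ⟨hinj, by simp [ZMod.card]⟩
  rw [Finset.prod_range]
  exact hbij.prod_comp g

/-- The function `i ↦ q ^ i` on `ZMod N`, where `q ^ N = 1`. -/
def qPow (q : k) (i : ZMod N) : k := q ^ i.val

lemma qPow_add_one [NeZero N] {q : k} (hq : q ^ N = 1) (i : ZMod N) : qPow q (i + 1) = qPow q i * q := by
  simpa [qPow] using pow_val_add_natCast hq i 1

lemma qPow_pow {q : k} (hq : q ^ N = 1) (i : ZMod N) : qPow q i ^ N = 1 := by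
  rw [qPow, ← pow_mul, mul_comm, pow_mul, hq, one_pow]

lemma qPow_ne_zero {q : k} (hq : q ≠ 0) (i : ZMod N) : qPow q i ≠ 0 := pow_ne_zero _ hq

/-- Relations in a representation by weighted shifts. -/
lemma relations_shiftOp [NeZero N] {M : ℕ} {q lam w α : k} {c : ZMod N → k} (hqN : q ^ N = 1)
    (hw : w ^ (M * N) = 1) (hα : α ^ N = 1 - w ^ N) (hα0 : α ≠ 0)
    (hc : ∀ i, c (i + 1) - q * c i = lam * (1 - w ^ 2 * qPow q i ^ 2))
    (hprod : ∏ i, c i = (α ^ N) ^ 2) :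
    Relations M N q lam (mulOp fun i ↦ w * qPow q i) (shiftOp (-1) fun _ ↦ α)
      (shiftOp 1 fun i ↦ c (i + 1) * α⁻¹) where
  h_pow := by
    refine LinearMap.ext fun f ↦ funext fun i ↦ ?_
    rw [mulOp_pow_apply, mul_pow, mul_comm N M, hw, mul_comm M N, pow_mul, qPow_pow hqN]
    simp
  h_a₁ := by
    refine LinearMap.ext fun f ↦ funext fun i ↦ ?_
    have h1 := qPow_add_one hqN (i + -1)
    rw [neg_add_cancel_right] at h1
    change w * qPow q i * (α * f (i + -1)) = q • (α * (w * qPow q (i + -1) * f (i + -1)))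
    rw [h1, smul_eq_mul]
    ring
  h_a₂ := by
    refine LinearMap.ext fun f ↦ funext fun i ↦ ?_
    have hq0 : q ≠ 0 := by
      rintro rfl
      rw [zero_pow (NeZero.ne N)] at hqN
      exact zero_ne_one hqN
    change w * qPow q i * (c (i + 1) * α⁻¹ * f (i + 1)) =
      q⁻¹ • (c (i + 1) * α⁻¹ * (w * qPow q (i + 1) * f (i + 1)))
    rw [qPow_add_one hqN, smul_eq_mul]
    field_simp
  a₁_pow := by
    refine LinearMap.ext fun f ↦ funext fun i ↦ ?_
    rw [shiftOp_pow_apply, LinearMap.sub_apply, Pi.sub_apply, mulOp_pow_apply, mul_pow,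
      qPow_pow hqN]
    simp [hα, sub_mul]
  a₂_pow := by
    refine LinearMap.ext fun f ↦ funext fun i ↦ ?_
    -- The weights run once through the whole cycle, so the product is α^(2N) / α^N = α^N.
    have h1 : ∏ j ∈ Finset.range N, (c (i + j * 1 + 1) * α⁻¹) = 1 - w ^ N := by
      rw [Finset.prod_mul_distrib, Finset.prod_const, Finset.card_range, ← hα]
      have h2 : ∏ j ∈ Finset.range N, c (i + j * 1 + 1) = ∏ x, c x := by
        rw [← prod_range_eq_prod_zmod c (i + 1)]
        exact Finset.prod_congr rfl fun j _ ↦ by congr 1; ring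
      rw [h2, hprod, inv_pow]
      field_simp
    rw [shiftOp_pow_apply, LinearMap.sub_apply, Pi.sub_apply, mulOp_pow_apply, mul_pow,
      qPow_pow hqN, h1]
    simp [sub_mul]
  a₂_a₁ := by
    refine LinearMap.ext fun f ↦ funext fun i ↦ ?_
    rw [LinearMap.smul_apply, LinearMap.sub_apply, LinearMap.sub_apply, Pi.smul_apply,
      Pi.sub_apply, Pi.sub_apply, mulOp_pow_apply]
    change c (i + 1) * α⁻¹ * (α * f (i + 1 + -1)) -
      q • (α * (c (i + -1 + 1) * α⁻¹ * f (i + -1 + 1))) =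
        lam • (f i - (w * qPow q i) ^ 2 * f i)
    rw [add_neg_cancel_right, neg_add_cancel_right, smul_eq_mul, smul_eq_mul]
    have h1 := hc i
    field_simp
    linear_combination f i * h1

open Polynomial in
-- A product of nonconstant linear polynomials in s is nonconstant, hence takes every value.
lemma exists_prod_add_eq [IsAlgClosed k] {ι : Type*} [Fintype ι] [Nonempty ι] (u e : ι → k)
    (hu : ∀ i, u i ≠ 0) (r : k) : ∃ s : k, ∏ i, (u i * s + e i) = r := by
  have hdeg : (∏ i, (C (u i) * X + C (e i)) : k[X]).degree = Fintype.card ι := by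
    rw [degree_prod]
    simp [degree_linear (hu _)]
  have hdeg' : (∏ i, (C (u i) * X + C (e i)) - C r : k[X]).degree ≠ 0 := by
    rw [degree_sub_C]
    · rw [hdeg]
      exact_mod_cast Fintype.card_ne_zero
    · rw [hdeg]
      exact_mod_cast Fintype.card_pos
  obtain ⟨s, hs⟩ := IsAlgClosed.exists_root _ hdeg'
  refine ⟨s, ?_⟩
  simpa [IsRoot, eval_prod, sub_eq_zero] using hs

end Representation

/-! ### The order of h -/

section Order

variable {k : Type*} [Field k] [IsAlgClosed k] [CharZero k] {M N : ℕ} {q : k}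

/-- The generator `h` acts with a primitive `M * N`-th root of unity as an eigenvalue. -/
lemma exists_relations (hM : 1 < M) (hN : 1 < N) (hq : IsPrimitiveRoot q N) (lam : k) :
    ∃ (w : k) (x y z : Module.End k (ZMod N → k)), IsPrimitiveRoot w (M * N) ∧
      Relations M N q lam x y z ∧ ∀ (n : ℕ) f, (x ^ n) f 0 = w ^ n * f 0 := by
  have : NeZero N := ⟨by omega⟩
  have : NeZero ((M * N : ℕ) : k) := ⟨by
    rw [Nat.cast_ne_zero]
    exact (Nat.mul_pos (by omega) (by omega)).ne'⟩
  obtain ⟨w, hw⟩ := HasEnoughRootsOfUnity.exists_primitiveRoot k (M * N)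
  have hw1 : 1 - w ^ N ≠ 0 := by
    rw [sub_ne_zero, ne_comm]
    exact hw.pow_ne_one_of_pos_of_lt (by omega) (by nlinarith)
  obtain ⟨α, hα⟩ := IsAlgClosed.exists_pow_nat_eq (1 - w ^ N) (n := N) (by omega)
  have hα0 : α ≠ 0 := by
    rintro rfl
    rw [zero_pow (by omega)] at hα
    exact hw1 hα.symm
  have hq0 : q ≠ 0 := hq.ne_zero (by omega)
  have hq1 : q - 1 ≠ 0 := sub_ne_zero.2 (hq.ne_one hN)
  -- The recurrence c(i+1) - q c(i) = λ(1 - w² q^(2i)) has the solutions s q^i plus the particular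
  -- solution vanishing at i = 0. It depends on i only through q^i, so it is well defined on Z/N.
  -- The free parameter s adjusts the product of the weights.
  obtain ⟨s, hs⟩ := exists_prod_add_eq (fun i : ZMod N ↦ qPow q i)
    (fun i ↦ lam * ((qPow q i - 1) / (q - 1)) * (1 - w ^ 2 * qPow q i / q))
    (fun i ↦ qPow_ne_zero hq0 i) ((α ^ N) ^ 2)
  refine ⟨w, _, _, _, hw, relations_shiftOp hq.pow_eq_one hw.pow_eq_one hα hα0 (fun i ↦ ?_) hs,
    fun n f ↦ ?_⟩
  · rw [qPow_add_one hq.pow_eq_one]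
    field_simp
    ring
  · rw [mulOp_pow_apply]
    simp [qPow]

variable (lam : k)

/-- In the representation, h^n multiplies the value at 0 by w^n, so h^n = 1 forces w^n = 1. -/
theorem orderOf_h (hM : 1 < M) (hN : 1 < N) (hq : IsPrimitiveRoot q N) :
    orderOf (h M N q lam) = M * N := by
  obtain ⟨w, x, y, z, hw, H, hx⟩ := exists_relations hM hN hq lam
  refine Nat.dvd_antisymm (orderOf_dvd_of_pow_eq_one (relations_gen M N q lam).h_pow') ?_
  refine hw.dvd_of_pow_eq_one _ ?_
  have h1 := congrArg (lift H) (pow_orderOf_eq_one (h M N q lam))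
  rw [map_pow, lift_h, map_one] at h1
  have h2 := hx (orderOf (h M N q lam)) 1
  rw [h1] at h2
  simpa using h2.symm

lemma nontrivial_B (hM : 1 < M) (hN : 1 < N) (hq : IsPrimitiveRoot q N) :
    Nontrivial (B M N q lam) := by
  by_contra hn
  rw [not_nontrivial_iff_subsingleton] at hn
  have h1 := orderOf_h lam hM hN hq
  rw [Subsingleton.elim (h M N q lam) 1, orderOf_one] at h1
  nlinarith

end Order

end LiftedPlane

namespace LiftedPlane

/-! ### The Hopf algebra structure -/

section Relations

variable {k A : Type*} [Field k] [Ring A] [Algebra k A] {M N : ℕ} {q lam : k} {h a₁ a₂ : A}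

lemma relations_counit (hN : N ≠ 0) : Relations M N q lam (1 : k) 0 0 := by
  constructor <;> simp [hN]

/-- This makes Δ well defined. The N-th powers are additive by the q-binomial theorem, for q and q⁻¹
respectively; in the last relation the mixed terms cancel because h commutes with a₁ and a₂ up to
inverse scalars. -/
lemma Relations.tensor (H : Relations M N q lam h a₁ a₂) (hN : 1 < N)
    (hq : IsPrimitiveRoot q N) :
    Relations M N q lam (h ⊗ₜ[k] h) (a₁ ⊗ₜ[k] (1 : A) + h ⊗ₜ[k] a₁)
      (a₂ ⊗ₜ[k] (1 : A) + h ⊗ₜ[k] a₂) where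
  h_pow := by rw [Algebra.TensorProduct.tmul_pow, H.h_pow, Algebra.TensorProduct.one_def]
  h_a₁ := by
    simp only [mul_add, add_mul, Algebra.TensorProduct.tmul_mul_tmul, H.h_a₁, mul_one, one_mul,
      smul_add, TensorProduct.tmul_smul, TensorProduct.smul_tmul']
  h_a₂ := by
    simp only [mul_add, add_mul, Algebra.TensorProduct.tmul_mul_tmul, H.h_a₂, mul_one, one_mul,
      smul_add, TensorProduct.tmul_smul, TensorProduct.smul_tmul']
  a₁_pow := by
    rw [hq.add_pow_of_qcomm hN (by simp [H.h_a₁, TensorProduct.smul_tmul'])]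
    simp only [Algebra.TensorProduct.tmul_pow, H.a₁_pow, one_pow, TensorProduct.sub_tmul,
      TensorProduct.tmul_sub, Algebra.TensorProduct.one_def]
    abel
  a₂_pow := by
    rw [hq.inv.add_pow_of_qcomm hN (by simp [H.h_a₂, TensorProduct.smul_tmul'])]
    simp only [Algebra.TensorProduct.tmul_pow, H.a₂_pow, one_pow, TensorProduct.sub_tmul,
      TensorProduct.tmul_sub, Algebra.TensorProduct.one_def]
    abel
  a₂_a₁ := by
    have hq0 : q ≠ 0 := hq.ne_zero (by omega)
    have h1 : a₂ * a₁ = q • (a₁ * a₂) + lam • (1 - h ^ 2) := by rw [← H.a₂_a₁]; abel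
    simp only [mul_add, add_mul, Algebra.TensorProduct.tmul_mul_tmul, H.h_a₁, H.h_a₂, h1, mul_one,
      one_mul, ← TensorProduct.smul_tmul', TensorProduct.tmul_smul, TensorProduct.sub_tmul,
      TensorProduct.add_tmul, TensorProduct.tmul_add, Algebra.TensorProduct.tmul_pow,
      TensorProduct.tmul_sub, Algebra.TensorProduct.one_def, ← pow_two, smul_add, smul_smul,
      mul_inv_cancel₀ hq0, one_smul, one_pow]
    module

/-- The product is q^(N(N-1)/2), which is 1 for odd N; for even N it is an odd power of q^(N/2) =
-1. -/
lemma _root_.IsPrimitiveRoot.neg_one_pow_mul_prod_range {q : k} (hq : IsPrimitiveRoot q N)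
    (hN : 0 < N) : (-1) ^ N * ∏ i ∈ Finset.range N, q ^ i = -1 := by
  rw [Finset.prod_pow_eq_pow_sum]
  have h1 := Finset.sum_range_id_mul_two N
  obtain ⟨m, rfl | rfl⟩ := Nat.even_or_odd' N
  · have hm : q ^ m = -1 := by
      have h2 : q ^ m * q ^ m = 1 := by rw [← pow_add, ← two_mul, hq.pow_eq_one]
      exact (mul_self_eq_one_iff.1 h2).resolve_left
        (hq.pow_ne_one_of_pos_of_lt (by omega) (by omega))
    have h2 : ∑ i ∈ Finset.range (2 * m), i = m * (2 * (m - 1) + 1) := by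
      obtain ⟨m, rfl⟩ : ∃ n, m = n + 1 := ⟨m - 1, by omega⟩
      rw [show 2 * (m + 1) - 1 = 2 * m + 1 by omega] at h1
      rw [Nat.add_sub_cancel]
      linarith
    rw [h2, pow_mul q, hm, pow_mul, neg_one_sq, one_pow, one_mul, pow_succ, pow_mul, neg_one_sq,
      one_pow, one_mul]
  · have h2 : ∑ i ∈ Finset.range (2 * m + 1), i = (2 * m + 1) * m := by
      rw [Nat.add_sub_cancel] at h1
      linarith
    rw [h2, pow_mul q, hq.pow_eq_one, one_pow, mul_one, pow_succ, pow_mul, neg_one_sq, one_pow,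
      one_mul]

lemma mul_pow_of_qcomm {g a : A} {q : k} (hag : a * g = q • (g * a)) (n : ℕ) :
    (g * a) ^ n = (∏ i ∈ Finset.range n, q ^ i) • (g ^ n * a ^ n) := by
  induction n with
  | zero => simp
  | succ n ih =>
    rw [pow_succ, ih, smul_mul_assoc, Finset.prod_range_succ, mul_smul]
    congr 1
    rw [mul_assoc, ← mul_assoc _ g a, pow_mul_of_qcomm hag, smul_mul_assoc, mul_smul_comm]
    congr 1
    rw [pow_succ, pow_succ]
    simp only [mul_assoc]

/-- For g = h⁻¹ this is the power relation for the antipode image -h⁻¹a: sign and powers of q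
combine to -1, and -g^N(1 - h^N) = 1 - g^N. -/
lemma neg_mul_pow_of_qcomm {g a : A} {q : k} (hN : 0 < N) (hq : IsPrimitiveRoot q N)
    (hag : a * g = q • (g * a)) (ha : a ^ N = 1 - h ^ N) (hg : g ^ N * h ^ N = 1) :
    (-(g * a)) ^ N = 1 - g ^ N := by
  rw [neg_pow, mul_pow_of_qcomm hag, ha, mul_sub, hg, mul_one, mul_smul_comm,
    show ((-1 : A) ^ N) = algebraMap k A ((-1) ^ N) by simp, ← Algebra.smul_def, smul_smul,
    mul_comm, hq.neg_one_pow_mul_prod_range hN]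
  simp

open MulOpposite in
-- The antipode reverses products, so it is built as an algebra map into the opposite algebra; with
-- g = h⁻¹ these are its values on the generators.
lemma Relations.op (H : Relations M N q lam h a₁ a₂) (hN : 0 < N) (hq : IsPrimitiveRoot q N)
    {g : A} (hg : g * h = 1) (hg' : h * g = 1) :
    Relations M N q lam (op g) (op (-(g * a₁))) (op (-(g * a₂))) := by
  have hq0 : q ≠ 0 := hq.ne_zero (by omega)
  have e₁ : a₁ * g = q • (g * a₁) := by
    calc a₁ * g = g * (h * a₁) * g := by rw [← mul_assoc g, hg, one_mul]
      _ = _ := by rw [H.h_a₁, mul_smul_comm, smul_mul_assoc, ← mul_assoc, mul_assoc _ h g, hg',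
        mul_one]
  have e₂ : a₂ * g = q⁻¹ • (g * a₂) := by
    calc a₂ * g = g * (h * a₂) * g := by rw [← mul_assoc g, hg, one_mul]
      _ = _ := by rw [H.h_a₂, mul_smul_comm, smul_mul_assoc, ← mul_assoc, mul_assoc _ h g, hg',
        mul_one]
  have hc : Commute g h := by rw [Commute, SemiconjBy, hg, hg']
  have hgn : ∀ n, g ^ n * h ^ n = 1 := fun n ↦ by rw [← hc.mul_pow, hg, one_pow]
  constructor
  · rw [← op_pow, ← op_one]
    have := hgn (N * M)
    rw [H.h_pow, mul_one] at this
    rw [this]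
  · rw [← op_mul, ← op_mul, ← op_smul]
    congr 1
    rw [neg_mul, mul_neg, mul_assoc, e₁, mul_smul_comm, smul_neg]
  · rw [← op_mul, ← op_mul, ← op_smul]
    congr 1
    rw [neg_mul, mul_neg, mul_assoc, e₂, mul_smul_comm, smul_neg]
  · rw [← op_pow, neg_mul_pow_of_qcomm hN hq e₁ H.a₁_pow (hgn N), op_sub, op_one, op_pow]
  · rw [← op_pow, neg_mul_pow_of_qcomm hN hq.inv e₂ H.a₂_pow (hgn N), op_sub, op_one, op_pow]
  · rw [← op_mul, ← op_mul, ← op_smul, ← op_sub, ← op_pow, ← op_one, ← op_sub, ← op_smul]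
    congr 1
    have h1 : a₂ * a₁ = q • (a₁ * a₂) + lam • (1 - h ^ 2) := by rw [← H.a₂_a₁]; abel
    have h2 : g * (g * (a₂ * a₁)) = q • (g ^ 2 * (a₁ * a₂)) + lam • (g ^ 2 - 1) := by
      rw [h1, ← mul_assoc, ← pow_two, mul_add, mul_smul_comm, mul_smul_comm, mul_sub, mul_one,
        hgn 2]
    rw [neg_mul_neg, neg_mul_neg, mul_assoc, ← mul_assoc a₁, e₁, mul_assoc g a₂, ← mul_assoc a₂ g,
      e₂, smul_mul_assoc, smul_mul_assoc, mul_smul_comm, mul_smul_comm, smul_smul,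
      mul_inv_cancel₀ hq0, one_smul, mul_assoc g a₁, mul_assoc g a₂, h2]
    rw [← mul_assoc g g, ← pow_two]
    module

end Relations

/-! ### The antipode axioms on products -/

section Antipode

variable {k A : Type*} [Field k] [Ring A] [Bialgebra k A]

/-- In S(u')S(t')t''u'' the inner factor S(t')t'' sums to a scalar and can be pulled out. -/
lemma mul'_rTensor_mul {S : A →ₗ[k] A} (hS : ∀ x y, S (x * y) = S y * S x) {c : k}
    {t : A ⊗[k] A} (ht : LinearMap.mul' k A (S.rTensor A t) = algebraMap k A c) (u : A ⊗[k] A) :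
    LinearMap.mul' k A (S.rTensor A (t * u)) = c • LinearMap.mul' k A (S.rTensor A u) := by
  have h1 : ∀ (x y : A) (t : A ⊗[k] A), LinearMap.mul' k A (S.rTensor A (t * (x ⊗ₜ y))) =
      S x * LinearMap.mul' k A (S.rTensor A t) * y := by
    intro x y t
    induction t using TensorProduct.induction_on with
    | zero => simp
    | tmul a b => simp [hS, mul_assoc]
    | add a b ha hb => simp only [add_mul, map_add, ha, hb, mul_add]
  induction u using TensorProduct.induction_on with
  | zero => simp
  | tmul x y =>
    rw [h1, ht, ← Algebra.commutes, mul_assoc, ← Algebra.smul_def]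
    simp
  | add x y hx hy => rw [mul_add, map_add, map_add, hx, hy, map_add, map_add, smul_add]

lemma mul'_lTensor_mul {S : A →ₗ[k] A} (hS : ∀ x y, S (x * y) = S y * S x) {c : k}
    {u : A ⊗[k] A} (hu : LinearMap.mul' k A (S.lTensor A u) = algebraMap k A c) (t : A ⊗[k] A) :
    LinearMap.mul' k A (S.lTensor A (t * u)) = c • LinearMap.mul' k A (S.lTensor A t) := by
  have h1 : ∀ (x y : A) (u : A ⊗[k] A), LinearMap.mul' k A (S.lTensor A ((x ⊗ₜ y) * u)) =
      x * LinearMap.mul' k A (S.lTensor A u) * S y := by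
    intro x y u
    induction u using TensorProduct.induction_on with
    | zero => simp
    | tmul a b => simp [hS, mul_assoc]
    | add a b ha hb => simp only [add_mul, map_add, ha, hb, mul_add]
  induction t using TensorProduct.induction_on with
  | zero => simp
  | tmul x y =>
    rw [h1, hu, ← Algebra.commutes, mul_assoc, ← Algebra.smul_def]
    simp
  | add x y hx hy => rw [add_mul, map_add, map_add, hx, hy, map_add, map_add, smul_add]

/-- It suffices to check the antipode axioms on generators. -/
lemma antipode_of_adjoin {S : A →ₗ[k] A} (hS : ∀ x y, S (x * y) = S y * S x) (hS1 : S 1 = 1)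
    {s : Set A} (hs : Algebra.adjoin k s = ⊤)
    (hl : ∀ x ∈ s, LinearMap.mul' k A (S.rTensor A (Coalgebra.comul (R := k) x)) =
      algebraMap k A (Coalgebra.counit x))
    (hr : ∀ x ∈ s, LinearMap.mul' k A (S.lTensor A (Coalgebra.comul (R := k) x)) =
      algebraMap k A (Coalgebra.counit x)) (x : A) :
    LinearMap.mul' k A (S.rTensor A (Coalgebra.comul (R := k) x)) =
      algebraMap k A (Coalgebra.counit x) ∧
    LinearMap.mul' k A (S.lTensor A (Coalgebra.comul (R := k) x)) =
      algebraMap k A (Coalgebra.counit x) := by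
  have hx : x ∈ Algebra.adjoin k s := hs ▸ trivial
  induction hx using Algebra.adjoin_induction with
  | mem x hx => exact ⟨hl x hx, hr x hx⟩
  | algebraMap r =>
    rw [Bialgebra.comul_algebraMap, Bialgebra.counit_algebraMap, Algebra.algebraMap_eq_smul_one,
      Algebra.TensorProduct.one_def]
    simp [hS1, Algebra.algebraMap_eq_smul_one]
  | add x y _ _ hx hy => simp only [map_add, hx, hy, and_self]
  | mul x y _ _ hx hy =>
    rw [Bialgebra.comul_mul, Bialgebra.counit_mul, mul'_rTensor_mul hS hx.1,
      mul'_lTensor_mul hS hy.2, hy.1, hx.2, map_mul, ← Algebra.smul_def]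
    exact ⟨rfl, by rw [Algebra.smul_def, Algebra.smul_def, Algebra.commutes]⟩

end Antipode

section Existence

variable {k : Type*} [Field k] {M N : ℕ} {q : k} (lam : k)

/-- The bialgebra structure on `B(M, N, q, λ)`. -/
@[reducible] noncomputable def bialgebra (hN : 1 < N) (hq : IsPrimitiveRoot q N) :
    Bialgebra k (B M N q lam) :=
  Bialgebra.ofAlgHom (lift ((relations_gen M N q lam).tensor hN hq))
    (lift (relations_counit (by omega)))
    (by apply algHom_ext <;>
      simp [TensorProduct.tmul_add, TensorProduct.add_tmul, add_assoc,
        Algebra.TensorProduct.one_def])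
    (by apply algHom_ext <;> simp)
    (by apply algHom_ext <;> simp)

lemma h_pow_pred_mul_h (hMN : 0 < M * N) :
    h M N q lam ^ (M * N - 1) * h M N q lam = 1 ∧ h M N q lam * h M N q lam ^ (M * N - 1) = 1 := by
  rw [← pow_succ, ← pow_succ', Nat.sub_add_cancel hMN, (relations_gen M N q lam).h_pow']
  exact ⟨rfl, rfl⟩

lemma add_mul_neg_mul_eq_zero {A : Type*} [Ring A] {h g : A} (hg : h * g = 1) (a : A) :
    a + h * -(g * a) = 0 := by
  rw [mul_neg, ← mul_assoc, hg, one_mul, add_neg_cancel]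

theorem exists_isStandard (hM : 0 < M) (hN : 1 < N) (hq : IsPrimitiveRoot q N) :
    ∃ H : HopfStructure k (B M N q lam), IsStandard H := by
  let _ := bialgebra (M := M) lam hN hq
  have hg := h_pow_pred_mul_h (M := M) (N := N) (q := q) lam (Nat.mul_pos hM (by omega))
  set g := h M N q lam ^ (M * N - 1) with hgdef
  let T := lift ((relations_gen M N q lam).op (by omega) hq hg.1 hg.2)
  let S : B M N q lam →ₗ[k] B M N q lam :=
    (MulOpposite.opLinearEquiv k).symm.toLinearMap ∘ₗ T.toLinearMap
  have hS : ∀ x y, S (x * y) = S y * S x := fun x y ↦ by simp [S]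
  have hS1 : S 1 = 1 := by simp [S]
  have hSh : S (h M N q lam) = g := by simp [S, T]
  have hSa₁ : S (a₁ M N q lam) = -(g * a₁ M N q lam) := by simp [S, T]
  have hSa₂ : S (a₂ M N q lam) = -(g * a₂ M N q lam) := by simp [S, T]
  have ch : Coalgebra.comul (R := k) (h M N q lam) = h M N q lam ⊗ₜ h M N q lam :=
    lift_h _
  have c₁ : Coalgebra.comul (R := k) (a₁ M N q lam) =
      a₁ M N q lam ⊗ₜ 1 + h M N q lam ⊗ₜ a₁ M N q lam := lift_a₁ _
  have c₂ : Coalgebra.comul (R := k) (a₂ M N q lam) =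
      a₂ M N q lam ⊗ₜ 1 + h M N q lam ⊗ₜ a₂ M N q lam := lift_a₂ _
  have eh : Coalgebra.counit (R := k) (h M N q lam) = 1 := lift_h _
  have e₁ : Coalgebra.counit (R := k) (a₁ M N q lam) = 0 := lift_a₁ _
  have e₂ : Coalgebra.counit (R := k) (a₂ M N q lam) = 0 := lift_a₂ _
  have hanti := antipode_of_adjoin hS hS1 (adjoin_gen M N q lam)
    (by
      rintro x (rfl | rfl | rfl)
      · rw [ch, eh]
        simp [hSh, hg.1]
      · rw [c₁, e₁]
        simp [hSh, hSa₁]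
      · rw [c₂, e₂]
        simp [hSh, hSa₂])
    (by
      rintro x (rfl | rfl | rfl)
      · rw [ch, eh]
        simp [hSh, hg.2]
      · rw [c₁, e₁]
        simpa [hS1, hSa₁] using add_mul_neg_mul_eq_zero hg.2 (a₁ M N q lam)
      · rw [c₂, e₂]
        simpa [hS1, hSa₂] using add_mul_neg_mul_eq_zero hg.2 (a₂ M N q lam))
  exact ⟨{ (inferInstance : Coalgebra k (B M N q lam)) with
      counit_one := Bialgebra.counit_one
      counit_mul := Bialgebra.counit_mul
      comul_one := Bialgebra.comul_one
      comul_mul := Bialgebra.comul_mul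
      antipode := S
      mul_antipode_rTensor_comul := LinearMap.ext fun x ↦ (hanti x).1
      mul_antipode_lTensor_comul := LinearMap.ext fun x ↦ (hanti x).2 }, ⟨ch, c₁, c₂⟩⟩

end Existence

/-! ### Uniqueness of the Hopf structure -/

section Uniqueness

/-- A Hopf structure is determined by its comultiplication and its counit. -/
lemma _root_.HopfStructure.ext_of_comul_of_counit {k A : Type*} [Field k] [Ring A] [Algebra k A]
    {H H' : HopfStructure k A} (hΔ : H.comul = H'.comul) (hε : H.counit = H'.counit) : H = H' := by
  obtain @⟨@⟨⟨Δ, ε⟩, ax₁, ax₂, ax₃⟩, p₁, p₂, p₃, p₄, S, hS, hS'⟩ := H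
  obtain @⟨@⟨⟨Δ', ε'⟩, ax₁', ax₂', ax₃'⟩, p₁', p₂', p₃', p₄', S', hT, hT'⟩ := H'
  subst hΔ
  subst hε
  let _ : Coalgebra k A := @Coalgebra.mk _ _ _ _ _ ⟨Δ, ε⟩ ax₁ ax₂ ax₃
  -- In the convolution algebra S is a left inverse and S' a right inverse of the identity, so they
  -- agree.
  have e1 : WithConv.toConv S * WithConv.toConv LinearMap.id = 1 := by
    ext x
    exact LinearMap.congr_fun hS x
  have e2 : WithConv.toConv LinearMap.id * WithConv.toConv S' = 1 := by
    ext x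
    exact LinearMap.congr_fun hT' x
  have e3 : S = S' := WithConv.toConv_injective (left_inv_eq_right_inv e1 e2)
  subst e3
  rfl

variable {k : Type*} [Field k] {M N : ℕ} {q lam : k}

/-- `IsStandard` prescribes only Δ, so ε must be derived: the counit axiom reads ε(h)h = h, and h is
invertible. -/
lemma IsStandard.counit_h {H : HopfStructure k (B M N q lam)} (hH : IsStandard H)
    [Nontrivial (B M N q lam)] (hMN : 0 < M * N) : H.counit (h M N q lam) = 1 := by
  have h1 := LinearMap.congr_fun H.rTensor_counit_comp_comul (h M N q lam)
  rw [LinearMap.comp_apply, hH.comul_h] at h1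
  have h2 := congrArg (TensorProduct.lid k _) h1
  simp only [LinearMap.rTensor_tmul, TensorProduct.lid_tmul, TensorProduct.mk_apply,
    one_smul] at h2
  have h3 := congrArg (· * h M N q lam ^ (M * N - 1)) h2
  simp only [smul_mul_assoc, (h_pow_pred_mul_h lam hMN).2] at h3
  rw [← Algebra.algebraMap_eq_smul_one] at h3
  exact (algebraMap k (B M N q lam)).injective (by rw [h3, map_one])

lemma counit_eq_zero_of_skewPrimitive {H : HopfStructure k (B M N q lam)}
    [Nontrivial (B M N q lam)] {g a : B M N q lam} (hg : H.counit g = 1)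
    (ha : H.comul a = a ⊗ₜ 1 + g ⊗ₜ a) : H.counit a = 0 := by
  have h1 := LinearMap.congr_fun H.rTensor_counit_comp_comul a
  rw [LinearMap.comp_apply, ha] at h1
  have h2 := congrArg (TensorProduct.lid k _) h1
  simp only [map_add, LinearMap.rTensor_tmul, TensorProduct.lid_tmul, TensorProduct.mk_apply, hg,
    one_smul, add_eq_right] at h2
  rw [← Algebra.algebraMap_eq_smul_one] at h2
  exact (algebraMap k (B M N q lam)).injective (by rw [h2, map_zero])

theorem IsStandard.eq {H H' : HopfStructure k (B M N q lam)} (hH : IsStandard H)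
    (hH' : IsStandard H') [Nontrivial (B M N q lam)] (hMN : 0 < M * N) : H = H' := by
  have hΔ : AlgHom.ofLinearMap H.comul H.comul_one H.comul_mul =
      AlgHom.ofLinearMap H'.comul H'.comul_one H'.comul_mul := by
    apply algHom_ext
    · exact hH.comul_h.trans hH'.comul_h.symm
    · exact hH.comul_a₁.trans hH'.comul_a₁.symm
    · exact hH.comul_a₂.trans hH'.comul_a₂.symm
  have hh := hH.counit_h hMN
  have hh' := hH'.counit_h hMN
  have hε : AlgHom.ofLinearMap H.counit H.counit_one H.counit_mul =
      AlgHom.ofLinearMap H'.counit H'.counit_one H'.counit_mul := by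
    apply algHom_ext
    · exact hh.trans hh'.symm
    · exact (counit_eq_zero_of_skewPrimitive hh hH.comul_a₁).trans
        (counit_eq_zero_of_skewPrimitive hh' hH'.comul_a₁).symm
    · exact (counit_eq_zero_of_skewPrimitive hh hH.comul_a₂).trans
        (counit_eq_zero_of_skewPrimitive hh' hH'.comul_a₂).symm
  exact HopfStructure.ext_of_comul_of_counit (LinearMap.ext (AlgHom.congr_fun hΔ))
    (LinearMap.ext (AlgHom.congr_fun hε))

end Uniqueness

end LiftedPlane

namespace LiftedPlane

/-! ### The main theorem -/

section

variable {k : Type*} [Field k] {M N : ℕ} {q lam lam' : k}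

/-- Rescaling a₁ by an N-th root of 1 affects only the last relation; this produces the isomorphisms
in the classification. -/
lemma Relations.smul_a₁ {A : Type*} [Ring A] [Algebra k A] {h a₁ a₂ : A}
    (H : Relations M N q lam h a₁ a₂) {u : k} (hu : u ^ N = 1) :
    Relations M N q (u * lam) h (u • a₁) a₂ where
  h_pow := H.h_pow
  h_a₁ := by rw [mul_smul_comm, H.h_a₁, smul_mul_assoc, smul_comm]
  h_a₂ := H.h_a₂
  a₁_pow := by rw [smul_pow, hu, one_smul, H.a₁_pow]
  a₂_pow := H.a₂_pow
  a₂_a₁ := by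
    rw [mul_smul_comm, smul_mul_assoc, smul_comm q, ← smul_sub, H.a₂_a₁, smul_smul]

theorem isomorphic_of_eq_mul [Nontrivial (B M N q lam)] [Nontrivial (B M N q lam')]
    (hMN : 0 < M * N) {H : HopfStructure k (B M N q lam)} {H' : HopfStructure k (B M N q lam')}
    (hH : IsStandard H) (hH' : IsStandard H') {u : k} (hu : u ^ N = 1) (hlam : lam' = u * lam) :
    H.Isomorphic H' := by
  have hN : N ≠ 0 := by rintro rfl; simp at hMN
  have hu0 : u ≠ 0 := by
    rintro rfl
    rw [zero_pow hN] at hu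
    exact zero_ne_one hu
  have hlam' : lam = u⁻¹ * lam' := by rw [hlam, inv_mul_cancel_left₀ hu0]
  have R : Relations M N q lam (h M N q lam') (u⁻¹ • a₁ M N q lam') (a₂ M N q lam') := by
    have h1 := (relations_gen M N q lam').smul_a₁ (u := u⁻¹) (by rw [inv_pow, hu, inv_one])
    rwa [← hlam'] at h1
  have R' : Relations M N q lam' (h M N q lam) (u • a₁ M N q lam) (a₂ M N q lam) := by
    have h1 := (relations_gen M N q lam).smul_a₁ hu
    rwa [← hlam] at h1
  let e : B M N q lam ≃ₐ[k] B M N q lam' := AlgEquiv.ofAlgHom (lift R) (lift R')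
    (by apply algHom_ext <;> simp [smul_smul, hu0])
    (by apply algHom_ext <;> simp [smul_smul, hu0])
  have eh : e (h M N q lam) = h M N q lam' := lift_h R
  have e₁ : e (a₁ M N q lam) = u⁻¹ • a₁ M N q lam' := lift_a₁ R
  have e₂ : e (a₂ M N q lam) = a₂ M N q lam' := lift_a₂ R
  let _ := H.toHopfAlgebra
  let _ := H'.toHopfAlgebra
  have hh := hH.counit_h hMN
  have hh' := hH'.counit_h hMN
  refine ⟨BialgEquiv.ofAlgEquiv e ?_ ?_⟩
  · apply algHom_ext
    · change H'.counit (e _) = H.counit _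
      rw [eh, hh, hh']
    · change H'.counit (e _) = H.counit _
      rw [e₁, map_smul, counit_eq_zero_of_skewPrimitive hh hH.comul_a₁,
        counit_eq_zero_of_skewPrimitive hh' hH'.comul_a₁, smul_zero]
    · change H'.counit (e _) = H.counit _
      rw [e₂, counit_eq_zero_of_skewPrimitive hh hH.comul_a₂,
        counit_eq_zero_of_skewPrimitive hh' hH'.comul_a₂]
  · have map_tmul : ∀ x y, Algebra.TensorProduct.map (e : B M N q lam →ₐ[k] B M N q lam')
        (e : B M N q lam →ₐ[k] B M N q lam') (x ⊗ₜ y) = e x ⊗ₜ e y := fun _ _ ↦ rfl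
    apply algHom_ext
    · change Algebra.TensorProduct.map _ _ (H.comul _) = H'.comul (e _)
      rw [hH.comul_h, eh, hH'.comul_h, map_tmul, eh]
    · change Algebra.TensorProduct.map _ _ (H.comul _) = H'.comul (e _)
      rw [hH.comul_a₁, e₁, map_smul, hH'.comul_a₁, map_add, map_tmul, map_tmul, eh, e₁, map_one,
        smul_add, TensorProduct.tmul_smul, ← TensorProduct.smul_tmul']
    · change Algebra.TensorProduct.map _ _ (H.comul _) = H'.comul (e _)
      rw [hH.comul_a₂, e₂, hH'.comul_a₂, map_add, map_tmul, map_tmul, eh, e₂, map_one]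

variable [IsAlgClosed k] [CharZero k]

lemma IsStandard.isLiftedPlane {H : HopfStructure k (B M N q lam)} (hH : IsStandard H)
    (hM : 1 < M) (hN : 2 < N) (hq : IsPrimitiveRoot q N) :
    letI := H.toHopfAlgebra
    IsLiftedPlane M N q lam (h M N q lam) (a₁ M N q lam) (a₂ M N q lam) :=
  have := nontrivial_B lam hM (by omega) hq
  letI := H.toHopfAlgebra
  { relations_gen M N q lam with
    one_lt_M := hM
    two_lt_N := hN
    isPrimitiveRoot := hq
    adjoin_eq_top := adjoin_gen M N q lam
    isGroupLikeElem := ⟨hH.counit_h (Nat.mul_pos (by omega) (by omega)), hH.comul_h⟩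
    comul_a₁ := hH.comul_a₁
    comul_a₂ := hH.comul_a₂
    orderOf_h := orderOf_h lam hM (by omega) hq }

theorem finrank_B (hM : 1 < M) (hN : 2 < N) (hq : IsPrimitiveRoot q N) (lam : k) :
    Module.finrank k (B M N q lam) = M * N ^ 3 := by
  obtain ⟨H, hH⟩ := exists_isStandard (M := M) lam (by omega) (by omega) hq
  let _ := H.toHopfAlgebra
  exact (hH.isLiftedPlane hM hN hq).finrank_eq

theorem existsUnique_isStandard (hM : 1 < M) (hN : 2 < N) (hq : IsPrimitiveRoot q N) (lam : k) :
    ∃! H : HopfStructure k (B M N q lam), IsStandard H := by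
  have := nontrivial_B lam hM (by omega) hq
  obtain ⟨H, hH⟩ := exists_isStandard (M := M) lam (by omega) (by omega) hq
  exact ⟨H, hH, fun H' hH' ↦ hH'.eq hH (Nat.mul_pos (by omega) (by omega))⟩

theorem isPointed_B (hM : 1 < M) (hN : 2 < N) (hq : IsPrimitiveRoot q N)
    {H : HopfStructure k (B M N q lam)} (hH : IsStandard H) :
    letI := H.toCoalgebra
    IsPointedCoalgebra k (B M N q lam) :=
  letI := H.toHopfAlgebra
  (hH.isLiftedPlane hM hN hq).isPointedCoalgebra

theorem isomorphic_iff (hM : 1 < M) (hN : 2 < N) (hq : IsPrimitiveRoot q N)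
    {H : HopfStructure k (B M N q lam)} {H' : HopfStructure k (B M N q lam')}
    (hH : IsStandard H) (hH' : IsStandard H') :
    H.Isomorphic H' ↔ ∃ u : k, u ^ N = 1 ∧ lam' = u * lam := by
  have := nontrivial_B lam hM (by omega) hq
  have := nontrivial_B lam' hM (by omega) hq
  constructor
  · let _ := H.toHopfAlgebra
    let _ := H'.toHopfAlgebra
    rintro ⟨e⟩
    exact IsLiftedPlane.exists_eq_mul_of_equiv (hH.isLiftedPlane hM hN hq)
      (hH'.isLiftedPlane hM hN hq) e
  · rintro ⟨u, hu, hlam⟩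
    exact isomorphic_of_eq_mul (Nat.mul_pos (by omega) (by omega)) hH hH' hu hlam

/-- λ^N is an isomorphism invariant, and in characteristic 0 distinct natural numbers have distinct
N-th powers. -/
theorem not_isomorphic_natCast (hM : 1 < M) (hN : 2 < N) (hq : IsPrimitiveRoot q N) {m n : ℕ}
    (hmn : m ≠ n) {H : HopfStructure k (B M N q (m : k))} {H' : HopfStructure k (B M N q (n : k))}
    (hH : IsStandard H) (hH' : IsStandard H') : ¬ H.Isomorphic H' := by
  rw [isomorphic_iff hM hN hq hH hH']
  rintro ⟨u, hu, hnm⟩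
  have h1 : (n : k) ^ N = (m : k) ^ N := by rw [hnm, mul_pow, hu, one_mul]
  have h2 : n ^ N = m ^ N := by exact_mod_cast h1
  exact hmn (Nat.pow_left_injective (by omega) h2).symm

end

/-- Finiteness fails if there is a sequence of pairwise non-isomorphic Hopf algebras. -/
lemma not_kaplanskyFiniteness.{u} {k : Type u} [Field k] {d : ℕ} (hd : (d : k) ≠ 0)
    (A : ℕ → Type u) [∀ n, Ring (A n)] [∀ n, Algebra k (A n)] (H : ∀ n, HopfStructure k (A n))
    (hA : ∀ n, Module.finrank k (A n) = d) (hiso : ∀ m n, m ≠ n → ¬ (H m).Isomorphic (H n)) :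
    ¬ KaplanskyFiniteness k d := by
  intro hK
  obtain ⟨r, S, hS⟩ := hK hd
  have h1 : ∀ n, ∃ i, letI := (H n).toHopfAlgebra; Nonempty (A n ≃ₐc[k] S i) := fun n ↦
    letI := (H n).toHopfAlgebra
    hS (HopfAlgCat.of k (A n)) (hA n)
  choose i hi using h1
  -- By the pigeonhole principle two of the algebras are isomorphic to the same representative,
  -- hence to each other.
  obtain ⟨m, n, hmn, him⟩ := Finite.exists_ne_map_eq_of_infinite i
  refine hiso m n hmn ?_
  let _ := (H m).toHopfAlgebra
  let _ := (H n).toHopfAlgebra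
  obtain ⟨e⟩ := hi m
  obtain ⟨e'⟩ := hi n
  rw [← him] at e'
  exact ⟨e.trans e'.symm⟩

end LiftedPlane

theorem theorem6p1 {k : Type*} [Field k] [IsAlgClosed k] [CharZero k] :
    (∀ (M N : ℕ) (q : k), 1 < M → 2 < N → IsPrimitiveRoot q N →
      -- dimension
      (∀ lam : k, Module.finrank k (LiftedPlane.B M N q lam) = M * N ^ 3) ∧
      -- the Hopf algebra structure
      (∀ lam : k, ∃! H : HopfStructure k (LiftedPlane.B M N q lam), LiftedPlane.IsStandard H) ∧
      (∀ (lam : k) (H : HopfStructure k (LiftedPlane.B M N q lam)), LiftedPlane.IsStandard H →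
        letI := H.toCoalgebra
        letI h := LiftedPlane.h M N q lam
        letI a₁ := LiftedPlane.a₁ M N q lam
        letI a₂ := LiftedPlane.a₂ M N q lam
        -- pointedness
        IsPointedCoalgebra k (LiftedPlane.B M N q lam) ∧
        -- the group-like elements form a cyclic group of order `M * N` generated by `h`
        orderOf h = M * N ∧
        (∀ g : LiftedPlane.B M N q lam, IsGroupLikeElem k g ↔ ∃ i : ℕ, g = h ^ i) ∧
        -- the coradical filtration
        (∀ n : ℕ, coradicalFiltration k (LiftedPlane.B M N q lam) n =
          Submodule.span k {x | ∃ i j₁ j₂ : ℕ, i ≤ N * M ∧ j₁ + j₂ ≤ n ∧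
            x = h ^ i * a₁ ^ j₁ * a₂ ^ j₂}) ∧
        -- the skew-primitive elements
        skewPrimitives k h 1 = Submodule.span k {1 - h, a₁, a₂} ∧
        LinearIndependent k ![1 - h, a₁, a₂] ∧
        (∀ g : LiftedPlane.B M N q lam, IsGroupLikeElem k g → g ≠ h →
          skewPrimitives k g 1 = Submodule.span k {1 - g})) ∧
      -- the isomorphism classification
      (∀ (lam lam' : k) (H : HopfStructure k (LiftedPlane.B M N q lam))
        (H' : HopfStructure k (LiftedPlane.B M N q lam')),
        LiftedPlane.IsStandard H → LiftedPlane.IsStandard H' →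
        (H.Isomorphic H' ↔ ∃ u : k, u ^ N = 1 ∧ lam' = u * lam))) ∧
    -- infinitely many pointed Hopf algebras of dimension `p ^ 4`
    (∀ p : ℕ, p.Prime → p ≠ 2 →
      (∃ q : k, IsPrimitiveRoot q p) ∧
      (∀ q : k, IsPrimitiveRoot q p →
        ∃ (lam : ℕ → k) (H : ∀ n, HopfStructure k (LiftedPlane.B p p q (lam n))),
          (∀ n, LiftedPlane.IsStandard (H n)) ∧
          (∀ n, Module.finrank k (LiftedPlane.B p p q (lam n)) = p ^ 4) ∧
          (∀ n, letI := (H n).toCoalgebra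
            IsPointedCoalgebra k (LiftedPlane.B p p q (lam n))) ∧
          (∀ m n, m ≠ n → ¬ (H m).Isomorphic (H n))) ∧
      ¬ KaplanskyFiniteness k (p ^ 4)) := by
  refine ⟨fun M N q hM hN hq ↦ ⟨LiftedPlane.finrank_B hM hN hq,
    LiftedPlane.existsUnique_isStandard hM hN hq, fun lam H hH ↦ ?_,
    fun lam lam' H H' hH hH' ↦ LiftedPlane.isomorphic_iff hM hN hq hH hH'⟩, fun p hp hp2 ↦ ?_⟩
  · let _ := H.toHopfAlgebra
    have hL := hH.isLiftedPlane hM hN hq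
    exact ⟨hL.isPointedCoalgebra, hL.orderOf_h, hL.isGroupLikeElem_iff,
      hL.coradicalFiltration_eq, hL.skewPrimitives_h, hL.linearIndependent_skewPrimitives,
      fun g hg hne ↦ hL.skewPrimitives_of_ne hg hne⟩
  · have hp1 : 1 < p := hp.one_lt
    have hp3 : 2 < p := lt_of_le_of_ne hp.two_le hp2.symm
    have key : ∀ q : k, IsPrimitiveRoot q p →
        ∃ (lam : ℕ → k) (H : ∀ n, HopfStructure k (LiftedPlane.B p p q (lam n))),
          (∀ n, LiftedPlane.IsStandard (H n)) ∧
          (∀ n, Module.finrank k (LiftedPlane.B p p q (lam n)) = p ^ 4) ∧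
          (∀ n, letI := (H n).toCoalgebra
            IsPointedCoalgebra k (LiftedPlane.B p p q (lam n))) ∧
          (∀ m n, m ≠ n → ¬ (H m).Isomorphic (H n)) := by
      intro q hq
      choose H hH using fun n : ℕ ↦
        LiftedPlane.exists_isStandard (M := p) (n : k) hp.pos hp1 hq
      exact ⟨fun n ↦ n, H, hH,
        fun n ↦ (LiftedPlane.finrank_B hp1 hp3 hq _).trans (pow_succ' p 3).symm,
        fun n ↦ LiftedPlane.isPointed_B hp1 hp3 hq (hH n),
        fun m n hmn ↦ LiftedPlane.not_isomorphic_natCast hp1 hp3 hq hmn (hH m) (hH n)⟩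
    have : NeZero (p : k) := ⟨Nat.cast_ne_zero.2 hp.ne_zero⟩
    obtain ⟨q, hq⟩ := HasEnoughRootsOfUnity.exists_primitiveRoot k p
    refine ⟨⟨q, hq⟩, key, ?_⟩
    obtain ⟨lam, H, -, hdim, -, hiso⟩ := key q hq
    exact LiftedPlane.not_kaplanskyFiniteness
      (Nat.cast_ne_zero.2 (pow_ne_zero _ hp.ne_zero)) _ H hdim hiso
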